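/- Let $(\mathcal X,\mathcal S,\mu)$ be a probability space, let $\mathcal C\subseteq\mathcal S$ be a family of measurable sets, and let $T$ be a strong mixing measure-preserving transformation of $(\mathcal X,\mathcal S,\mu)$, i.e. $\mu(A\cap T^{-n}B)\to\mu(A)\mu(B)$ for all $A,B\in\mathcal S$. The entropy of $\mathcal C$ is $$H(\mathcal C)=\sup_{(C_1,C_2,\dots)}\ \liminf_{n\to\infty}\frac1n H_\mu\Big(\bigvee_{i=1}^n C_i\Big),$$ where the supremum is over all sequences of members of $\mathcal C$ (and is $0$ if $\mathcal C=\emptyset$), $\bigvee_{i=1}^n C_i$ is the partition of $\mathcal X$ into the cells $\tilde C_1\cap\dots\cap\tilde C_n$ with $\tilde C_i\in\{C_i,C_i^c\}$, and $H_\mu(\Pi)=-\sum_{A\in\Pi}\mu(A)\log_2\mu(A)$ with $0\log_2 0=0$. (i) If $H(\mathcal C)=0$, then $T$ is uniformly strong mixing on $\mathcal C$: $$\lim_{n\to\infty}\ \sup_{A,B\in\mathcal C}\big|\mu(A\cap T^{-n}B)-\mu(A)\mu(B)\big|=0 .$$ (ii) Suppose in addition that $(\mathcal X,\mathcal S,\mu)$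 is a Lebesgue space (isomorphic modulo null sets, possibly after completion, to an interval with Lebesgue measure together with at most countably many atoms) and that $T$ is invertible modulo null sets. Let $\Phi$ be the space of invertible measure-preserving transformations of $(\mathcal X,\mathcal S,\mu)$, where transformations are taken modulo null sets, i.e. are required to be defined, measurable and invertible only up to null sets and are identified when they agree almost everywhere, with the weak topology, in which $\phi_r\to\phi$ if and only if $\mu(\phi_rA\,\triangle\,\phi A)\to0$ for every $A\in\mathcal S$. For $\phi\in\Phi$ put $T_\phi=\phi^{-1}\circ T\circ\phi$. If $H(\mathcal C)>0$, then there is a dense $G_\delta$ set $G\subseteq\Phi$ such that for every $\phi\in G$ $$\limsup_{n\to\infty}\ \sup_{C\in\mathcal C}\big|\mu(C\cap T_\phi^{-n}C)-\mu(C)^2\big|>0 .$$ -/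

import Mathlib

open MeasureTheory Filter Topology
open scoped ENNReal symmDiff

namespace UniformMixing

/-! ## Entropy of a family of sets -/

section Entropy

variable {X : Type*} [MeasurableSpace X]

/-- The cell of the join of `S 0, …, S (n - 1)` that lies inside `S i` when `ε i = true` and inside
the complement of `S i` when `ε i = false`. -/
def joinCell (S : ℕ → Set X) (n : ℕ) (ε : Fin n → Bool) : Set X :=
  ⋂ i : Fin n, if ε i = true then S i else (S i)ᶜ

/-- The entropy, with logarithms in base two, of the join of `S 0, …, S (n - 1)`. Cells attached to
different sign patterns are disjoint, and a null cell contributes `0`, so this is the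
entropy `-∑ μ(A) log₂ μ(A)` of the partition into the cells of positive measure. -/
noncomputable def joinEntropy (μ : Measure X) (S : ℕ → Set X) (n : ℕ) : ℝ :=
  ∑ ε : Fin n → Bool, -(μ.real (joinCell S n ε) * Real.logb 2 (μ.real (joinCell S n ε)))

/-- The entropy of an ordered sequence of sets. -/
noncomputable def seqEntropy (μ : Measure X) (S : ℕ → Set X) : ℝ≥0∞ :=
  liminf (fun n : ℕ => ENNReal.ofReal ((1 / (n : ℝ)) * joinEntropy μ S n)) atTop

/-- The entropy of a family of sets: the supremum over all sequences of members of the family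
(repetitions allowed). -/
noncomputable def familyEntropy (μ : Measure X) (𝒞 : Set (Set X)) : ℝ≥0∞ :=
  ⨆ S : ℕ → Set X, ⨆ _ : ∀ i, S i ∈ 𝒞, seqEntropy μ S

end Entropy

/-! ## Strong mixing -/

/-- `T` is a strong mixing measure-preserving transformation of `μ`. -/
structure IsStrongMixing {X : Type*} [MeasurableSpace X] (T : X → X) (μ : Measure X) : Prop where
  measurePreserving : MeasurePreserving T μ μ
  mixing : ∀ A B : Set X, MeasurableSet A → MeasurableSet B →
    Tendsto (fun n : ℕ => |μ.real (A ∩ T^[n] ⁻¹' B) - μ.real A * μ.real B|) atTop (𝓝 0)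

/-! ## Isomorphism modulo null sets, Lebesgue spaces -/

/-- `f` is a measure-preserving map for the completed sigma-algebras. If `μ` is complete this
is the usual notion. If `Y` is a standard Borel space, these maps are exactly the maps
that are almost everywhere equal to a measure-preserving map in the usual sense. -/
structure PreservesModNull {X Y : Type*} [MeasurableSpace X] [MeasurableSpace Y]
    (f : X → Y) (μ : Measure X) (ν : Measure Y) : Prop where
  nullMeasurable : NullMeasurable f μ
  measure_preimage : ∀ s : Set Y, MeasurableSet s → μ (f ⁻¹' s) = ν s

/-- An isomorphism modulo null sets of measure spaces, given together with an inverse. -/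
structure ModZeroIso {X Y : Type*} [MeasurableSpace X] [MeasurableSpace Y]
    (μ : Measure X) (ν : Measure Y) where
  toFun : X → Y
  invFun : Y → X
  preserves_toFun : PreservesModNull toFun μ ν
  preserves_invFun : PreservesModNull invFun ν μ
  left_inv : ∀ᵐ x ∂μ, invFun (toFun x) = x
  right_inv : ∀ᵐ y ∂ν, toFun (invFun y) = y

/-- A Lebesgue space: isomorphic modulo null sets to an interval `[0, a)` with Lebesgue measure
together with at most countably many atoms, placed at the points `1, 2, 3, …`. (For a probability
measure `μ` the existence of the isomorphism forces the total mass to be one, so `a ≤ 1`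
and the atoms lie outside the interval.) The sigma-algebra need not be complete. -/
def IsLebesgueSpace {X : Type*} [MeasurableSpace X] (μ : Measure X) : Prop :=
  ∃ (a : ℝ) (w : ℕ → ℝ≥0∞), Nonempty (ModZeroIso μ
    ((volume : Measure ℝ).restrict (Set.Ico 0 a) +
      Measure.sum (fun n : ℕ => w n • Measure.dirac ((n : ℝ) + 1))))

/-! ## The space of invertible measure-preserving transformations -/

section Transformations

variable {X : Type*} [MeasurableSpace X]

/-- An invertible measure-preserving transformation of `μ`, not yet identified modulo
almost everywhere equality. -/
abbrev InvTransf (μ : Measure X) := ModZeroIso μ μ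

/-- `T` is invertible as a transformation of `μ`. -/
def IsInvertible (T : X → X) (μ : Measure X) : Prop :=
  ∃ τ : InvTransf μ, τ.toFun = T

/-- The set `φ A`, as the preimage of `A` under the inverse of `φ`: modulo null sets the only
meaningful version of the image, as `φ` is arbitrary on a null set. -/
def InvTransf.image {μ : Measure X} (φ : InvTransf μ) (A : Set X) : Set X :=
  φ.invFun ⁻¹' A

/-- The conjugate `φ⁻¹ ∘ T ∘ φ`. -/
def conj {μ : Measure X} (T : X → X) (φ : InvTransf μ) : X → X :=
  φ.invFun ∘ T ∘ φ.toFun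

/-- The weak topology: generated by the sets `{ψ | μ (ψ A ∆ φ A) < ε}` with `A` measurable, so
that `φ_r → φ` if and only if `μ (φ_r A ∆ φ A) → 0` for every measurable `A`. -/
instance weakTopology (μ : Measure X) : TopologicalSpace (InvTransf μ) :=
  TopologicalSpace.generateFrom
    {U | ∃ (φ : InvTransf μ) (A : Set X) (ε : ℝ≥0∞), MeasurableSet A ∧ 0 < ε ∧
      U = {ψ : InvTransf μ | μ (InvTransf.image ψ A ∆ InvTransf.image φ A) < ε}}

/-- Almost everywhere equality of transformations. -/
def aeEqSetoid (μ : Measure X) : Setoid (InvTransf μ) where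
  r φ ψ := φ.toFun =ᵐ[μ] ψ.toFun
  iseqv := ⟨fun _ => EventuallyEq.rfl, fun h => h.symm, fun h h' => h.trans h'⟩

/-- The space `Φ` of invertible measure-preserving transformations of `μ`, where transformations
that agree almost everywhere are identified. -/
def TransfSpace (μ : Measure X) := Quotient (aeEqSetoid μ)

/-- The class of a transformation in `Φ`. -/
def TransfSpace.mk {μ : Measure X} (φ : InvTransf μ) : TransfSpace μ :=
  Quotient.mk (aeEqSetoid μ) φ

/-- The weak topology on `Φ`. The generating sets above do not separate transformations that agree
almost everywhere, so the open sets of `Φ` are the images of the open sets above. -/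
instance (μ : Measure X) : TopologicalSpace (TransfSpace μ) :=
  TopologicalSpace.coinduced TransfSpace.mk (weakTopology μ)

end Transformations

end UniformMixing

/-! Both parts rest on one dichotomy: `𝒞` has zero entropy exactly when it is totally bounded for
the pseudometric `μ(A ∆ B)`, used here in the form that one finite partition approximates every
member of `𝒞` by a union of its cells. If such partitions exist, a sequence from `𝒞` is, up to a
small density of errors, determined by one finite label, so its entropy rate vanishes
(`familyEntropy_eq_zero`). If not, a greedy choice gives a sequence each term of which is `η`-far
from every union of cells of the preceding join, and each term adds at least `η` bits
(`familyEntropy_pos`).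

For (i), mixing is uniform over the finitely many unions of cells, and correlations are Lipschitz in
the sets.

For (ii), Baire's theorem is applied to the sets `lateCorrelated` of `φ` for which some `φC`, with
`C` in `𝒞`, is correlated with itself by a fixed amount at some time past `N`. They are open
because, for fixed `C` and time, the correlation depends continuously on `φC`. For density
(`dense_lateCorrelated`), given `φ₀`, a finite label records the approximate positions of `y` and of
`φ₀⁻¹y`. Some `C` in `𝒞` is far from the unions of cells of the label transported by `φ₀`.
Rearranging `φ₀C` inside the cells gives a set `D` with large late self-correlation
(`IsStrongMixing.exists_correlated`), and an automorphism that preserves the cells carries `φ₀C` to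
`D`. Composing with it hardly moves `φ₀` or its inverse.

The set `D` comes from a uniformly distributed function `u` that is almost invariant under `Tⁿ`:
cutting `u ∘ T^M` at a threshold `θ i` that depends on the cell gives overlap about `∑ pᵢ pⱼ min(θᵢ,
θⱼ)`, which exceeds `(∑ pᵢ θᵢ)²` by at least `(∑ pᵢ min(θᵢ, 1 - θᵢ))²`.

Baire's theorem is used in the `L¹` distance between coordinate expressions of transformations and
of their inverses. This distance is complete and its topology refines the weak one, so dense sets
remain dense in the weak topology and in the quotient. -/

namespace UniformMixing

/-! ## Finite labels and total boundedness -/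

section Labels

variable {X : Type*} [MeasurableSpace X]

/-- A family of sets is totally bounded if, up to arbitrarily small error, all its members are
unions of cells of one finite measurable partition. -/
def IsTotallyBoundedFamily (μ : Measure X) (𝒞 : Set (Set X)) : Prop :=
  ∀ ε : ℝ, 0 < ε → ∃ (k : ℕ) (c : X → Fin k), Measurable c ∧
    ∀ C ∈ 𝒞, ∃ V : Set (Fin k), μ.real (C ∆ (c ⁻¹' V)) < ε

/-- An arbitrary finite label type is allowed so that sign patterns and pairs of levels can serve as
labels without re-indexing. -/
lemma exists_far_of_not_isTotallyBoundedFamily {μ : Measure X} {𝒞 : Set (Set X)}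
    (h : ¬ IsTotallyBoundedFamily μ 𝒞) :
    ∃ ε : ℝ, 0 < ε ∧ ∀ (ι : Type) [Fintype ι] [MeasurableSpace ι] [DiscreteMeasurableSpace ι]
      (c : X → ι), Measurable c → ∃ C ∈ 𝒞, ∀ V : Set ι, ε ≤ μ.real (C ∆ (c ⁻¹' V)) := by
  unfold IsTotallyBoundedFamily at h
  push Not at h
  obtain ⟨ε, hε, h⟩ := h
  refine ⟨ε, hε, fun ι _ _ _ c hc => ?_⟩
  obtain ⟨C, hC, hV⟩ := h (Fintype.card ι) (Fintype.equivFin ι ∘ c)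
    ((measurable_of_finite _).comp hc)
  refine ⟨C, hC, fun V => ?_⟩
  have := hV ((Fintype.equivFin ι).symm ⁻¹' V)
  rwa [Set.preimage_comp, ← Set.preimage_comp (f := Fintype.equivFin ι), Equiv.symm_comp_self,
    Set.preimage_id] at this

variable {ι : Type*} [Fintype ι] [MeasurableSpace ι] [DiscreteMeasurableSpace ι]

lemma measureReal_eq_sum_inter_preimage (μ : Measure X) [IsFiniteMeasure μ] {c : X → ι}
    (hc : Measurable c) (E : Set X) :
    μ.real E = ∑ i, μ.real (E ∩ c ⁻¹' {i}) := by
  classical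
  have h1 : ((μ.restrict E).map c).real Set.univ = ∑ i, ((μ.restrict E).map c).real {i} := by
    rw [← Finset.coe_univ, ← sum_measureReal_singleton]
  rw [map_measureReal_apply hc MeasurableSet.univ] at h1
  simp only [Set.preimage_univ, measureReal_restrict_apply MeasurableSet.univ, Set.univ_inter] at h1
  rw [h1]
  refine Finset.sum_congr rfl fun i _ => ?_
  rw [map_measureReal_apply hc (measurableSet_singleton i),
    measureReal_restrict_apply (hc (measurableSet_singleton i)), Set.inter_comm]

lemma sum_measureReal_mul_eq_integral (μ : Measure X) [IsFiniteMeasure μ] {c : X → ι}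
    (hc : Measurable c) (f : ι → ℝ) :
    ∑ i, μ.real (c ⁻¹' {i}) * f i = ∫ x, f (c x) ∂μ := by
  have : ∫ x, f (c x) ∂μ = ∫ i, f i ∂(μ.map c) :=
    (integral_map hc.aemeasurable (measurable_of_finite f).aestronglyMeasurable).symm
  rw [this, integral_fintype .of_finite]
  refine Finset.sum_congr rfl fun i _ => ?_
  rw [map_measureReal_apply hc (measurableSet_singleton i), smul_eq_mul]

/-- Majority vote: a cell is put into `V` when more than half of its mass lies in `A`, so the error
in each cell is the minority part. -/
lemma exists_symmDiff_preimage_le_sum_min (μ : Measure X) [IsFiniteMeasure μ] {c : X → ι}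
    (hc : Measurable c) (A : Set X) :
    ∃ V : Set ι, μ.real (A ∆ (c ⁻¹' V)) ≤
      ∑ i, min (μ.real (A ∩ c ⁻¹' {i})) (μ.real (Aᶜ ∩ c ⁻¹' {i})) := by
  refine ⟨{i | μ.real (Aᶜ ∩ c ⁻¹' {i}) < μ.real (A ∩ c ⁻¹' {i})}, ?_⟩
  rw [measureReal_eq_sum_inter_preimage μ hc]
  refine Finset.sum_le_sum fun i _ => ?_
  by_cases hi : μ.real (Aᶜ ∩ c ⁻¹' {i}) < μ.real (A ∩ c ⁻¹' {i})
  · rw [min_eq_right hi.le]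
    refine measureReal_mono ?_
    rintro x ⟨hx, rfl⟩
    rcases hx with hx | hx
    · exact absurd hi hx.2
    · exact ⟨hx.2, rfl⟩
  · rw [min_eq_left (not_lt.1 hi)]
    refine measureReal_mono ?_
    rintro x ⟨hx, rfl⟩
    rcases hx with hx | hx
    · exact ⟨hx.1, rfl⟩
    · exact absurd hx.1 hi

end Labels

/-! ## Entropy and total boundedness -/

section EntropyBounds

variable {X : Type*}

/-- The cell of the join of `S 0, …, S (n - 1)` in which a point lies, as a sign pattern. -/
noncomputable def joinName (S : ℕ → Set X) (n : ℕ) (x : X) : Fin n → Bool :=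
  open Classical in fun i => decide (x ∈ S i)

lemma joinName_preimage (S : ℕ → Set X) (n : ℕ) (ε : Fin n → Bool) :
    joinName S n ⁻¹' {ε} = joinCell S n ε := by
  ext x
  simp only [Set.mem_preimage, Set.mem_singleton_iff, joinCell, Set.mem_iInter, joinName,
    funext_iff]
  refine forall_congr' fun i => ?_
  cases ε i <;> simp

lemma joinCell_snoc_true (S : ℕ → Set X) (n : ℕ) (ε : Fin n → Bool) :
    joinCell S (n + 1) (Fin.snoc ε true) = S n ∩ joinName S n ⁻¹' {ε} := by
  rw [joinName_preimage]
  ext x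
  simp [joinCell, Fin.forall_fin_succ', and_comm]

lemma joinCell_snoc_false (S : ℕ → Set X) (n : ℕ) (ε : Fin n → Bool) :
    joinCell S (n + 1) (Fin.snoc ε false) = (S n)ᶜ ∩ joinName S n ⁻¹' {ε} := by
  rw [joinName_preimage]
  ext x
  simp [joinCell, Fin.forall_fin_succ', and_comm]

variable [MeasurableSpace X]

lemma measurable_joinName {S : ℕ → Set X} (n : ℕ) (hS : ∀ i < n, MeasurableSet (S i)) :
    Measurable (joinName S n) := by
  refine measurable_pi_lambda _ fun i => ?_
  refine measurable_to_bool ?_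
  convert hS i i.2 using 1
  ext x
  simp [joinName]

/-- Gibbs' inequality, from `log t ≤ t - 1` at `t = q i / p i`. -/
lemma sum_negMulLog_le_of_sum_eq_one {ι : Type*} [Fintype ι] {p q : ι → ℝ} (hp : ∀ i, 0 ≤ p i)
    (hq : ∀ i, 0 < q i) (hp1 : ∑ i, p i = 1) (hq1 : ∑ i, q i = 1) :
    ∑ i, -(p i * Real.log (p i)) ≤ ∑ i, p i * (-Real.log (q i)) := by
  have key : ∀ i, -(p i * Real.log (p i)) - p i * (-Real.log (q i)) ≤ q i - p i := by
    intro i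
    rcases (hp i).eq_or_lt with h | h
    · simp [← h, (hq i).le]
    · have h1 := Real.log_le_sub_one_of_pos (div_pos (hq i) h)
      rw [Real.log_div (hq i).ne' h.ne'] at h1
      have h2 := mul_le_mul_of_nonneg_left h1 h.le
      have h3 : p i * (q i / p i - 1) = q i - p i := by field_simp
      linarith
  have := Finset.sum_le_sum fun i (_ : i ∈ Finset.univ) => key i
  rw [Finset.sum_sub_distrib, Finset.sum_sub_distrib, hp1, hq1] at this
  linarith

lemma joinEntropy_eq (μ : Measure X) (S : ℕ → Set X) (n : ℕ) :
    joinEntropy μ S n = (∑ ε : Fin n → Bool,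
      -(μ.real (joinCell S n ε) * Real.log (μ.real (joinCell S n ε)))) / Real.log 2 := by
  rw [joinEntropy, Finset.sum_div]
  refine Finset.sum_congr rfl fun ε _ => ?_
  rw [Real.logb]
  ring

/-- Gibbs' inequality against a noisy code: pick one of the `k` labels uniformly, write down the
sign pattern it predicts, and flip each sign independently with probability `δ`. Encoding a point
through its own label costs `log k`, plus at most `-log (1 - δ)` per index and a further `-log δ`
for each index where the prediction is wrong. -/
lemma joinEntropy_le_of_label (μ : Measure X) [IsProbabilityMeasure μ] {S : ℕ → Set X}
    (hS : ∀ i, MeasurableSet (S i)) {k : ℕ} {c : X → Fin k} (hc : Measurable c)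
    {V : ℕ → Set (Fin k)} {η : ℝ} (hV : ∀ i, μ.real (S i ∆ (c ⁻¹' (V i))) ≤ η)
    {δ : ℝ} (hδ : 0 < δ) (hδ1 : δ < 1) (n : ℕ) :
    joinEntropy μ S n * Real.log 2 ≤
      Real.log k + n * (-Real.log (1 - δ) + -Real.log δ * η) := by
  classical
  obtain ⟨x₀⟩ : Nonempty X := nonempty_of_isProbabilityMeasure μ
  have hk : 0 < (k : ℝ) := by
    have := (c x₀).pos
    exact_mod_cast this
  have h1δ : 0 < 1 - δ := by linarith
  have hlogδ : 0 ≤ -Real.log δ := by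
    have := Real.log_nonpos hδ.le hδ1.le
    linarith
  have hlog1δ : 0 ≤ -Real.log (1 - δ) := by
    have := Real.log_nonpos h1δ.le (by linarith)
    linarith
  let b : Bool → Bool → ℝ := fun x y => if x = y then 1 - δ else δ
  have hb : ∀ x y, 0 < b x y := fun x y => by
    dsimp only [b]; split_ifs <;> assumption
  let s : Fin k → Fin n → Bool := fun a i => decide (a ∈ V i)
  let w : Fin k → (Fin n → Bool) → ℝ := fun a ε => ∏ i, b (ε i) (s a i)
  have hw : ∀ a ε, 0 < w a ε := fun a ε => Finset.prod_pos fun i _ => hb _ _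
  -- The comparison law: the uniform mixture of the product laws `w a`.
  let q : (Fin n → Bool) → ℝ := fun ε => (∑ a, w a ε) / k
  have hq : ∀ ε, 0 < q ε := fun ε =>
    div_pos (Finset.sum_pos (fun a _ => hw a ε) ⟨c x₀, Finset.mem_univ _⟩) hk
  have hw1 : ∀ a, ∑ ε, w a ε = 1 := by
    intro a
    have := Finset.prod_univ_sum (fun _ : Fin n => (Finset.univ : Finset Bool))
      (fun i x => b x (s a i))
    rw [Fintype.piFinset_univ] at this
    rw [← this]
    refine Finset.prod_eq_one fun i _ => ?_
    cases hsi : s a i <;> simp [b]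
  have hq1 : ∑ ε, q ε = 1 := by
    simp only [q]
    rw [← Finset.sum_div, Finset.sum_comm]
    simp only [hw1, Finset.sum_const, Finset.card_univ, Fintype.card_fin, nsmul_eq_mul, mul_one]
    exact div_self hk.ne'
  have hN := measurable_joinName n fun i _ => hS i
  have hp1 : ∑ ε : Fin n → Bool, μ.real (joinCell S n ε) = 1 := by
    have := measureReal_eq_sum_inter_preimage μ hN Set.univ
    simp only [Set.univ_inter, joinName_preimage, probReal_univ] at this
    exact this.symm
  have hmS : ∀ i, MeasurableSet (S i ∆ (c ⁻¹' (V i))) := fun i =>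
    (hS i).symmDiff (hc (MeasurableSet.of_discrete))
  rw [joinEntropy_eq, div_mul_cancel₀ _ (Real.log_pos one_lt_two).ne']
  refine (sum_negMulLog_le_of_sum_eq_one (fun _ => measureReal_nonneg) hq hp1 hq1).trans ?_
  simp only [← joinName_preimage]
  rw [sum_measureReal_mul_eq_integral μ hN]
  have hind : ∀ i : Fin n, Integrable
      (fun x => -Real.log δ * (S i ∆ (c ⁻¹' (V i))).indicator 1 x) μ :=
    fun i => ((integrable_const (1 : ℝ)).indicator (hmS i)).const_mul _
  have hint : ∀ i : Fin n, Integrable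
      (fun x => -Real.log (1 - δ) + -Real.log δ * (S i ∆ (c ⁻¹' (V i))).indicator 1 x) μ :=
    fun i => (integrable_const _).add (hind i)
  have hpt : ∀ x, -Real.log (q (joinName S n x)) ≤ Real.log k + ∑ i : Fin n,
      (-Real.log (1 - δ) + -Real.log δ * (S i ∆ (c ⁻¹' (V i))).indicator 1 x) := by
    intro x
    have h1 : w (c x) (joinName S n x) / k ≤ q (joinName S n x) := by
      dsimp only [q]
      gcongr
      exact Finset.single_le_sum (f := fun a => w a (joinName S n x)) (fun a _ => (hw a _).le)
        (Finset.mem_univ _)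
    have h2 := Real.log_le_log (div_pos (hw _ _) hk) h1
    rw [Real.log_div (hw _ _).ne' hk.ne', Real.log_prod (fun i _ => (hb _ _).ne')] at h2
    have h3 : ∑ i : Fin n, -Real.log (b (joinName S n x i) (s (c x) i)) ≤ ∑ i : Fin n,
        (-Real.log (1 - δ) + -Real.log δ * (S i ∆ (c ⁻¹' (V i))).indicator 1 x) := by
      refine Finset.sum_le_sum fun i _ => ?_
      by_cases hx : x ∈ S i ∆ (c ⁻¹' (V i))
      · rw [Set.indicator_of_mem hx]
        dsimp only [b]
        split_ifs
        · simp [hlogδ]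
        · simpa using hlog1δ
      · rw [Set.indicator_of_notMem hx]
        have : joinName S n x i = s (c x) i := by
          simp only [Set.mem_symmDiff, Set.mem_preimage] at hx
          simp only [joinName, s, decide_eq_decide]
          tauto
        simp [b, this]
    rw [Finset.sum_neg_distrib] at h3
    linarith
  calc ∫ x, -Real.log (q (joinName S n x)) ∂μ
      ≤ ∫ x, (Real.log k + ∑ i : Fin n,
          (-Real.log (1 - δ) + -Real.log δ * (S i ∆ (c ⁻¹' (V i))).indicator 1 x)) ∂μ := by
        refine integral_mono ?_ ((integrable_const _).add (integrable_finsetSum _ fun i _ => hint i))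
          hpt
        exact Integrable.of_bound (C := ∑ ε, ‖-Real.log (q ε)‖)
          ((measurable_of_finite (fun ε => -Real.log (q ε))).comp hN).aestronglyMeasurable
          (Eventually.of_forall fun x => Finset.single_le_sum
            (f := fun ε => ‖-Real.log (q ε)‖) (fun _ _ => norm_nonneg _) (Finset.mem_univ _))
    _ = Real.log k + ∑ i : Fin n,
          (-Real.log (1 - δ) + -Real.log δ * μ.real (S i ∆ (c ⁻¹' (V i)))) := by
        rw [integral_add (integrable_const _) (integrable_finsetSum _ fun i _ => hint i),
          integral_finsetSum _ fun i _ => hint i]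
        congr 1
        · simp
        · refine Finset.sum_congr rfl fun i _ => ?_
          rw [integral_add (integrable_const _) (hind i),
            integral_const_mul]
          have : ∫ x, (S i ∆ (c ⁻¹' (V i))).indicator 1 x ∂μ = μ.real (S i ∆ (c ⁻¹' (V i))) :=
            integral_indicator_one (hmS i)
          rw [this]
          simp
    _ ≤ Real.log k + ∑ i : Fin n, (-Real.log (1 - δ) + -Real.log δ * η) := by
        gcongr with i
        exact hV i
    _ = _ := by
        rw [Finset.sum_const, Finset.card_univ, Fintype.card_fin, nsmul_eq_mul]

theorem familyEntropy_eq_zero (μ : Measure X) [IsProbabilityMeasure μ] {𝒞 : Set (Set X)}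
    (h𝒞 : ∀ C ∈ 𝒞, MeasurableSet C) (h : IsTotallyBoundedFamily μ 𝒞) :
    familyEntropy μ 𝒞 = 0 := by
  simp only [familyEntropy, ENNReal.iSup_eq_zero]
  intro S hS
  refine le_antisymm (ENNReal.le_of_forall_pos_le_add fun ε hε _ => ?_) zero_le
  rw [zero_add]
  have hε' : (0 : ℝ) < ε := hε
  have hlog2 : 0 < Real.log 2 := Real.log_pos one_lt_two
  -- Three costs per index, namely `log k / n`, `-log (1 - δ)` and `-log δ` times the approximation
  -- error, are each kept at most `r`; together they stay below `ε log 2`. The flip rate `δ` is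
  -- fixed before the label, whose accuracy depends on it.
  obtain ⟨r, hr⟩ : ∃ r : ℝ, r = ε * Real.log 2 / 4 := ⟨_, rfl⟩
  have hr0 : 0 < r := by rw [hr]; positivity
  obtain ⟨δ, hδ, hδ1, hδr⟩ : ∃ δ : ℝ, 0 < δ ∧ δ < 1 ∧ -Real.log (1 - δ) < r := by
    have hcont : Tendsto (fun δ : ℝ => -Real.log (1 - δ)) (𝓝[>] 0) (𝓝 0) := by
      have : ContinuousAt (fun δ : ℝ => -Real.log (1 - δ)) 0 := by
        refine ((Real.continuousAt_log (by norm_num)).comp ?_).neg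
        fun_prop
      have h0 := this.tendsto
      simp only [sub_zero, Real.log_one, neg_zero] at h0
      exact h0.mono_left nhdsWithin_le_nhds
    have h1 : ∀ᶠ δ : ℝ in 𝓝[>] 0, δ ∈ Set.Ioo (0 : ℝ) 1 := Ioo_mem_nhdsGT one_pos
    obtain ⟨δ, h2, h3⟩ := (h1.and (hcont.eventually (gt_mem_nhds hr0))).exists
    exact ⟨δ, h2.1, h2.2, h3⟩
  have hlogδ : 0 < -Real.log δ := by
    have := Real.log_neg hδ hδ1
    linarith
  obtain ⟨k, c, hc, hV⟩ := h (r / (-Real.log δ)) (by positivity)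
  choose V hV using fun i => hV (S i) (hS i)
  have hbound := joinEntropy_le_of_label μ (fun i => h𝒞 _ (hS i)) hc (fun i => (hV i).le) hδ hδ1
  have hlim : Tendsto (fun n : ℕ => Real.log k / (n : ℝ)) atTop (𝓝 0) :=
    tendsto_const_nhds.div_atTop tendsto_natCast_atTop_atTop
  have hev : ∀ᶠ n : ℕ in atTop, (1 / (n : ℝ)) * joinEntropy μ S n ≤ ε := by
    filter_upwards [hlim.eventually (gt_mem_nhds hr0), eventually_gt_atTop 0] with n hn hn0
    have hn0' : (0 : ℝ) < n := by exact_mod_cast hn0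
    have h1 := hbound n
    rw [mul_div_cancel₀ _ hlogδ.ne'] at h1
    have h2 : Real.log k < r * n := by rwa [div_lt_iff₀ hn0'] at hn
    have h3 : joinEntropy μ S n * Real.log 2 ≤ (ε * n) * Real.log 2 := by
      have : (n : ℝ) * (-Real.log (1 - δ) + r) ≤ n * (r + r) := by gcongr
      have h4 : r * n + n * (r + r) = 3 / 4 * (ε * n * Real.log 2) := by rw [hr]; ring
      have h5 : 0 ≤ (ε : ℝ) * n * Real.log 2 := by positivity
      linarith
    have h4 := le_of_mul_le_mul_right h3 hlog2
    rw [one_div, inv_mul_le_iff₀ hn0']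
    linarith
  refine (liminf_le_of_le (by isBoundedDefault) fun b hb => ?_)
  obtain ⟨n, h1, h2⟩ := (hb.and hev).exists
  refine h1.trans ?_
  rw [← ENNReal.ofReal_coe_nnreal]
  exact ENNReal.ofReal_le_ofReal h2

/-- The entropy gained by splitting a cell of mass `a + b`: the smaller piece is at most half of the
cell, so its logarithm drops by at least `log 2`. -/
lemma min_mul_log_two_le {a b : ℝ} (ha : 0 ≤ a) (hb : 0 ≤ b) :
    min a b * Real.log 2 ≤ -(a * Real.log a) + -(b * Real.log b) + (a + b) * Real.log (a + b) := by
  wlog hab : a ≤ b generalizing a b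
  · have := this hb ha (not_le.1 hab).le
    rw [min_comm, add_comm a b]
    linarith
  rw [min_eq_left hab]
  rcases ha.eq_or_lt with rfl | ha
  · simp
  have hb' : 0 < b := ha.trans_le hab
  have h1 : Real.log 2 + Real.log a ≤ Real.log (a + b) := by
    rw [← Real.log_mul two_ne_zero ha.ne']
    exact Real.log_le_log (by positivity) (by linarith)
  have h2 : Real.log b ≤ Real.log (a + b) := Real.log_le_log hb' (by linarith)
  nlinarith [mul_le_mul_of_nonneg_left h1 ha.le, mul_le_mul_of_nonneg_left h2 hb'.le]

/-- Adding `S n` splits each old cell in two and gains at least the minority mass there, in bits.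
Summed over the cells, this bounds the distance from `S n` to the majority union of cells. -/
lemma joinEntropy_succ_ge (μ : Measure X) [IsProbabilityMeasure μ] {S : ℕ → Set X} {n : ℕ}
    (hS : ∀ i ≤ n, MeasurableSet (S i)) {η : ℝ}
    (hη : ∀ V : Set (Fin n → Bool), η ≤ μ.real (S n ∆ (joinName S n ⁻¹' V))) :
    joinEntropy μ S n + η ≤ joinEntropy μ S (n + 1) := by
  have hlog2 : 0 < Real.log 2 := Real.log_pos one_lt_two
  have hN := measurable_joinName n fun i hi => hS i hi.le
  obtain ⟨V, hV⟩ := exists_symmDiff_preimage_le_sum_min μ hN (S n)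
  have h1 := (hη V).trans hV
  refine le_of_mul_le_mul_right ?_ hlog2
  rw [add_mul, joinEntropy_eq, joinEntropy_eq, div_mul_cancel₀ _ hlog2.ne',
    div_mul_cancel₀ _ hlog2.ne', ← (Fin.snocEquiv fun _ => Bool).sum_comp, Fintype.sum_prod_type]
  have hsnoc : ∀ (b : Bool) (ε : Fin n → Bool),
      (Fin.snocEquiv fun _ => Bool) (b, ε) = (Fin.snoc ε b : Fin (n + 1) → Bool) := fun _ _ => rfl
  simp only [hsnoc, Fintype.sum_bool, joinCell_snoc_true, joinCell_snoc_false]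
  have h2 := mul_le_mul_of_nonneg_right h1 hlog2.le
  rw [Finset.sum_mul] at h2
  have h3 : ∀ ε : Fin n → Bool, _ := fun ε => min_mul_log_two_le
    (measureReal_nonneg (μ := μ) (s := S n ∩ joinName S n ⁻¹' {ε}))
    (measureReal_nonneg (μ := μ) (s := (S n)ᶜ ∩ joinName S n ⁻¹' {ε}))
  have h4 : ∀ ε : Fin n → Bool, μ.real (S n ∩ joinName S n ⁻¹' {ε}) +
      μ.real ((S n)ᶜ ∩ joinName S n ⁻¹' {ε}) = μ.real (joinCell S n ε) := by
    intro ε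
    rw [← joinName_preimage, Set.inter_comm, Set.inter_comm (S n)ᶜ, ← Set.sdiff_eq]
    exact measureReal_inter_add_sdiff (hS n le_rfl)
  simp only [h4] at h3
  have h5 := Finset.sum_le_sum fun ε (_ : ε ∈ Finset.univ) => h3 ε
  simp only [Finset.sum_add_distrib] at h5
  simp only [Finset.sum_neg_distrib] at h5 ⊢
  linarith

/-- A sequence can be chosen step by step, the next term depending on the previous ones. -/
lemma exists_seq_of_forall_exists {α : Type*} [Nonempty α] {r : ℕ → (ℕ → α) → α → Prop}
    (hr : ∀ n f g a, (∀ i < n, f i = g i) → r n f a → r n g a)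
    {P : α → Prop} (h : ∀ n f, (∀ i < n, P (f i)) → ∃ a, P a ∧ r n f a) :
    ∃ f : ℕ → α, (∀ n, P (f n)) ∧ ∀ n, r n f (f n) := by
  classical
  let next : ℕ → (ℕ → α) → α := fun n f =>
    if hf : ∀ i < n, P (f i) then (h n f hf).choose else Classical.arbitrary α
  -- `F n` is a whole sequence of which only the entries below `n` are final; the others hold a
  -- default value.
  let F : ℕ → ℕ → α := fun n => Nat.rec (fun _ => Classical.arbitrary α)
    (fun n f => Function.update f n (next n f)) n
  have hF : ∀ n, F (n + 1) = Function.update (F n) n (next n (F n)) := fun _ => rfl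
  have hstab : ∀ n i, i < n → F n i = F (i + 1) i := by
    intro n
    induction n with
    | zero => intro i hi; omega
    | succ n ih =>
      intro i hi
      rcases (Nat.lt_succ_iff.1 hi).eq_or_lt with rfl | hi'
      · rfl
      · rw [hF, Function.update_of_ne hi'.ne, ih i hi']
  have hP : ∀ n, P (F (n + 1) n) := by
    intro n
    induction n using Nat.strong_induction_on with
    | _ n ih =>
      have hf : ∀ i < n, P (F n i) := fun i hi => by rw [hstab n i hi]; exact ih i hi
      rw [hF, Function.update_self]
      simp only [next, dif_pos hf]
      exact (h n _ hf).choose_spec.1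
  refine ⟨fun n => F (n + 1) n, hP, fun n => ?_⟩
  have hf : ∀ i < n, P (F n i) := fun i hi => by rw [hstab n i hi]; exact hP i
  refine hr n (F n) _ _ (fun i hi => hstab n i hi) ?_
  beta_reduce
  rw [hF, Function.update_self]
  simp only [next, dif_pos hf]
  exact (h n _ hf).choose_spec.2

theorem familyEntropy_pos (μ : Measure X) [IsProbabilityMeasure μ] {𝒞 : Set (Set X)}
    (h𝒞 : ∀ C ∈ 𝒞, MeasurableSet C) (h : ¬ IsTotallyBoundedFamily μ 𝒞) :
    0 < familyEntropy μ 𝒞 := by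
  obtain ⟨η, hη, hfar⟩ := exists_far_of_not_isTotallyBoundedFamily h
  obtain ⟨S, hS, hSfar⟩ : ∃ S : ℕ → Set X, (∀ n, S n ∈ 𝒞) ∧
      ∀ n, ∀ V : Set (Fin n → Bool), η ≤ μ.real (S n ∆ (joinName S n ⁻¹' V)) := by
    refine exists_seq_of_forall_exists
      (r := fun n f C => ∀ V : Set (Fin n → Bool), η ≤ μ.real (C ∆ (joinName f n ⁻¹' V)))
      (fun n f g C hfg hf V => ?_) (fun n f hf => ?_)
    · have : joinName g n = joinName f n := by
        ext x i
        simp [joinName, hfg i i.2]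
      rw [this]
      exact hf V
    · exact hfar _ _ (measurable_joinName n fun i hi => h𝒞 _ (hf i hi))
  have hgrow : ∀ n : ℕ, n * η ≤ joinEntropy μ S n := by
    intro n
    induction n with
    | zero => simp [joinEntropy, joinCell]
    | succ n ih =>
      have := joinEntropy_succ_ge μ (n := n) (fun i _ => h𝒞 _ (hS i)) (hSfar n)
      push_cast
      linarith
  calc (0 : ℝ≥0∞) < ENNReal.ofReal η := by simpa using hη
    _ ≤ seqEntropy μ S := by
      refine le_liminf_of_le (by isBoundedDefault) ?_
      filter_upwards [eventually_gt_atTop 0] with n hn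
      have hn' : (0 : ℝ) < n := by exact_mod_cast hn
      refine ENNReal.ofReal_le_ofReal ?_
      rw [one_div, le_inv_mul_iff₀ hn']
      exact hgrow n
    _ ≤ familyEntropy μ 𝒞 := le_iSup₂ (f := fun S (_ : ∀ i, S i ∈ 𝒞) => seqEntropy μ S) S hS

end EntropyBounds

/-! ## Uniform mixing on totally bounded families -/

section UniformMixing

variable {X : Type*} [MeasurableSpace X]

lemma abs_measureReal_inter_preimage_sub_le {μ : Measure X} [IsFiniteMeasure μ] {S : X → X}
    (hS : MeasurePreserving S μ μ) {A A' B B' : Set X} (hA : NullMeasurableSet A μ)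
    (hA' : NullMeasurableSet A' μ) (hB : NullMeasurableSet B μ) (hB' : NullMeasurableSet B' μ) :
    |μ.real (A ∩ S ⁻¹' B) - μ.real (A' ∩ S ⁻¹' B')| ≤ μ.real (A ∆ A') + μ.real (B ∆ B') := by
  have hq := hS.quasiMeasurePreserving
  refine (abs_measureReal_sub_le_measureReal_symmDiff' (hA.inter (hB.preimage hq))
    (hA'.inter (hB'.preimage hq)) (measure_ne_top _ _) (measure_ne_top _ _)).trans ?_
  calc μ.real ((A ∩ S ⁻¹' B) ∆ (A' ∩ S ⁻¹' B'))
      ≤ μ.real ((A ∆ A') ∪ S ⁻¹' (B ∆ B')) := by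
        refine measureReal_mono fun x hx => ?_
        simp only [Set.mem_symmDiff, Set.mem_inter_iff, Set.mem_preimage, Set.mem_union] at hx ⊢
        tauto
    _ ≤ μ.real (A ∆ A') + μ.real (S ⁻¹' (B ∆ B')) := measureReal_union_le _ _
    _ = _ := by
        rw [hS.measureReal_preimage
          (show NullMeasurableSet (B ∆ B') μ from (hB.diff hB').union (hB'.diff hB))]

lemma abs_mul_sub_mul_le_of_le_one {a b a' b' : ℝ} (ha : 0 ≤ a') (ha1 : a' ≤ 1) (hb : 0 ≤ b)
    (hb1 : b ≤ 1) : |a * b - a' * b'| ≤ |a - a'| + |b - b'| := by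
  have : a * b - a' * b' = (a - a') * b + a' * (b - b') := by ring
  rw [this]
  refine (abs_add_le _ _).trans (add_le_add ?_ ?_)
  · rw [abs_mul, abs_of_nonneg hb]
    exact mul_le_of_le_one_right (abs_nonneg _) hb1
  · rw [abs_mul, abs_of_nonneg ha]
    exact mul_le_of_le_one_left (abs_nonneg _) ha1

/-- The bound does not depend on the map `S`, so one approximation of the sets serves all iterates
at once. -/
lemma abs_correlation_sub_le {μ : Measure X} [IsProbabilityMeasure μ] {S : X → X}
    (hS : MeasurePreserving S μ μ) {A A' B B' : Set X} (hA : NullMeasurableSet A μ)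
    (hA' : NullMeasurableSet A' μ) (hB : NullMeasurableSet B μ) (hB' : NullMeasurableSet B' μ) :
    |(μ.real (A ∩ S ⁻¹' B) - μ.real A * μ.real B) -
      (μ.real (A' ∩ S ⁻¹' B') - μ.real A' * μ.real B')| ≤
      2 * (μ.real (A ∆ A') + μ.real (B ∆ B')) := by
  have h1 := abs_measureReal_inter_preimage_sub_le hS hA hA' hB hB'
  have h2 := abs_mul_sub_mul_le_of_le_one (a := μ.real A) (b' := μ.real B')
    (measureReal_nonneg (μ := μ) (s := A')) measureReal_le_one
    (measureReal_nonneg (μ := μ) (s := B)) measureReal_le_one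
  have h3 := abs_measureReal_sub_le_measureReal_symmDiff' hA hA' (measure_ne_top μ _)
    (measure_ne_top μ _)
  have h4 := abs_measureReal_sub_le_measureReal_symmDiff' hB hB' (measure_ne_top μ _)
    (measure_ne_top μ _)
  rw [abs_le] at h1 h2 ⊢
  constructor <;> linarith [h1.1, h1.2, h2.1, h2.2]

theorem tendsto_iSup_correlation_of_isTotallyBoundedFamily {μ : Measure X}
    [IsProbabilityMeasure μ] {T : X → X} (hT : IsStrongMixing T μ) {𝒞 : Set (Set X)}
    (h𝒞 : ∀ C ∈ 𝒞, MeasurableSet C) (h : IsTotallyBoundedFamily μ 𝒞) :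
    Tendsto (fun n : ℕ => ⨆ A ∈ 𝒞, ⨆ B ∈ 𝒞,
      ENNReal.ofReal |μ.real (A ∩ T^[n] ⁻¹' B) - μ.real A * μ.real B|) atTop (𝓝 0) := by
  rw [ENNReal.tendsto_nhds_zero]
  intro ε hε
  obtain ⟨r, hr0, hr⟩ : ∃ r : ℝ, 0 < r ∧ ENNReal.ofReal r ≤ ε := by
    rcases eq_or_ne ε ⊤ with rfl | hε'
    · exact ⟨1, one_pos, le_top⟩
    · exact ⟨ε.toReal, ENNReal.toReal_pos hε.ne' hε', (ENNReal.ofReal_toReal hε').le⟩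
  obtain ⟨k, c, hc, hV⟩ := h (r / 8) (by positivity)
  have hmix : ∀ V W : Set (Fin k), ∀ᶠ n : ℕ in atTop,
      |μ.real (c ⁻¹' V ∩ T^[n] ⁻¹' (c ⁻¹' W)) - μ.real (c ⁻¹' V) * μ.real (c ⁻¹' W)| < r / 2 :=
    fun V W => (hT.mixing _ _ (hc .of_discrete) (hc .of_discrete)).eventually
      (gt_mem_nhds (by positivity))
  filter_upwards [eventually_all.2 fun V => eventually_all.2 (hmix V)] with n hn
  refine (iSup₂_le fun A hA => iSup₂_le fun B hB => ENNReal.ofReal_le_ofReal ?_).trans hr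
  obtain ⟨V, hV'⟩ := hV A hA
  obtain ⟨W, hW'⟩ := hV B hB
  have h1 := abs_correlation_sub_le (hT.measurePreserving.iterate n)
    (h𝒞 A hA).nullMeasurableSet (hc (.of_discrete (s := V))).nullMeasurableSet
    (h𝒞 B hB).nullMeasurableSet (hc (.of_discrete (s := W))).nullMeasurableSet
  have h2 := hn V W
  rw [abs_le] at *
  rw [abs_lt] at h2
  constructor <;> linarith [h1.1, h1.2, h2.1, h2.2]

end UniformMixing

/-! ## Maps preserving a measure modulo null sets -/

section ModNull

variable {X Y Z : Type*} [MeasurableSpace X] [MeasurableSpace Y] [MeasurableSpace Z]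
  {μ : Measure X} {ν : Measure Y} {ρ : Measure Z}

namespace PreservesModNull

lemma tendsto_ae {f : X → Y} (hf : PreservesModNull f μ ν) : Tendsto f (ae μ) (ae ν) := by
  intro s hs
  rw [mem_ae_iff] at hs
  obtain ⟨t, hst, ht, ht0⟩ := exists_measurable_superset_of_null hs
  rw [mem_map, mem_ae_iff, ← Set.preimage_compl]
  exact measure_mono_null (Set.preimage_mono hst) (by rw [hf.measure_preimage t ht, ht0])

lemma preimage_ae_eq {f : X → Y} (hf : PreservesModNull f μ ν) {s t : Set Y} (h : s =ᵐ[ν] t) :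
    f ⁻¹' s =ᵐ[μ] f ⁻¹' t :=
  h.comp_tendsto hf.tendsto_ae

lemma nullMeasurableSet_preimage {f : X → Y} (hf : PreservesModNull f μ ν) {s : Set Y}
    (hs : NullMeasurableSet s ν) : NullMeasurableSet (f ⁻¹' s) μ := by
  obtain ⟨t, ht, hst⟩ := hs
  exact (hf.nullMeasurable ht).congr (hf.preimage_ae_eq hst).symm

lemma measure_preimage₀ {f : X → Y} (hf : PreservesModNull f μ ν) {s : Set Y}
    (hs : NullMeasurableSet s ν) : μ (f ⁻¹' s) = ν s := by
  obtain ⟨t, ht, hst⟩ := hs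
  rw [measure_congr (hf.preimage_ae_eq hst), hf.measure_preimage t ht, measure_congr hst]

lemma measureReal_preimage {f : X → Y} (hf : PreservesModNull f μ ν) {s : Set Y}
    (hs : NullMeasurableSet s ν) : μ.real (f ⁻¹' s) = ν.real s := by
  rw [measureReal_def, hf.measure_preimage₀ hs, measureReal_def]

lemma comp {g : Y → Z} {f : X → Y} (hg : PreservesModNull g ν ρ) (hf : PreservesModNull f μ ν) :
    PreservesModNull (g ∘ f) μ ρ where
  nullMeasurable _ hs := hf.nullMeasurableSet_preimage (hg.nullMeasurable hs)
  measure_preimage s hs := by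
    rw [Set.preimage_comp, hf.measure_preimage₀ (hg.nullMeasurable hs), hg.measure_preimage s hs]

lemma congr {f f' : X → Y} (hf : PreservesModNull f μ ν) (h : f =ᵐ[μ] f') :
    PreservesModNull f' μ ν where
  nullMeasurable := hf.nullMeasurable.congr h
  measure_preimage s hs := by
    rw [← hf.measure_preimage s hs]
    exact measure_congr (h.symm.preimage s)

lemma of_measurePreserving {f : X → Y} (hf : MeasurePreserving f μ ν) :
    PreservesModNull f μ ν where
  nullMeasurable := hf.measurable.nullMeasurable
  measure_preimage _ hs := hf.measure_preimage hs.nullMeasurableSet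

lemma map_eq {f : X → Y} (hf : PreservesModNull f μ ν) (hfm : AEMeasurable f μ) :
    μ.map f = ν := by
  ext s hs
  rw [Measure.map_apply_of_aemeasurable hfm hs, hf.measure_preimage s hs]

lemma of_map_eq {f : X → Y} (hfm : AEMeasurable f μ) (h : μ.map f = ν) :
    PreservesModNull f μ ν where
  nullMeasurable _ hs := hfm.nullMeasurable hs
  measure_preimage s hs := by rw [← h, Measure.map_apply_of_aemeasurable hfm hs]

end PreservesModNull

namespace ModZeroIso

/-- The inverse isomorphism. -/
def symm (θ : ModZeroIso μ ν) : ModZeroIso ν μ where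
  toFun := θ.invFun
  invFun := θ.toFun
  preserves_toFun := θ.preserves_invFun
  preserves_invFun := θ.preserves_toFun
  left_inv := θ.right_inv
  right_inv := θ.left_inv

/-- The composition of isomorphisms modulo null sets. -/
def trans (θ : ModZeroIso μ ν) (κ : ModZeroIso ν ρ) : ModZeroIso μ ρ where
  toFun := κ.toFun ∘ θ.toFun
  invFun := θ.invFun ∘ κ.invFun
  preserves_toFun := κ.preserves_toFun.comp θ.preserves_toFun
  preserves_invFun := θ.preserves_invFun.comp κ.preserves_invFun
  left_inv := by
    filter_upwards [θ.left_inv, θ.preserves_toFun.tendsto_ae.eventually κ.left_inv] with x h1 h2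
    simp only [Function.comp_apply, h2, h1]
  right_inv := by
    filter_upwards [κ.right_inv, κ.preserves_invFun.tendsto_ae.eventually θ.right_inv] with x h1 h2
    simp only [Function.comp_apply, h2, h1]

/-- Replacing the underlying map by one that agrees with it almost everywhere. -/
def congrToFun (θ : ModZeroIso μ ν) (f : X → Y) (h : θ.toFun =ᵐ[μ] f) : ModZeroIso μ ν where
  toFun := f
  invFun := θ.invFun
  preserves_toFun := θ.preserves_toFun.congr h
  preserves_invFun := θ.preserves_invFun
  left_inv := by
    filter_upwards [θ.left_inv, h] with x h1 h2
    rw [← h2, h1]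
  right_inv := by
    filter_upwards [θ.right_inv, θ.preserves_invFun.tendsto_ae.eventually h] with x h1 h2
    rw [← h2, h1]

lemma preimage_invFun_preimage_toFun (θ : ModZeroIso μ ν) (A : Set X) :
    θ.toFun ⁻¹' (θ.invFun ⁻¹' A) =ᵐ[μ] A := by
  filter_upwards [θ.left_inv] with x hx
  change (θ.invFun (θ.toFun x) ∈ A) = (x ∈ A)
  rw [hx]

lemma preimage_toFun_preimage_invFun (θ : ModZeroIso μ ν) (A : Set Y) :
    θ.invFun ⁻¹' (θ.toFun ⁻¹' A) =ᵐ[ν] A :=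
  θ.symm.preimage_invFun_preimage_toFun A

end ModZeroIso

end ModNull

/-! ## Atomless measures on the line -/

section Atomless

variable (ρ : Measure ℝ) [IsFiniteMeasure ρ]

lemma monotone_measureReal_Iic : Monotone fun x => ρ.real (Set.Iic x) :=
  fun _ _ h => measureReal_mono (Set.Iic_subset_Iic.2 h)

variable [NullSingletonClass ρ]

lemma continuous_measureReal_Iic : Continuous fun x => ρ.real (Set.Iic x) := by
  have h : (fun x => ρ.real (Set.Iic x)) = fun x => ∫ y, (Set.Iic x).indicator 1 y ∂ρ := by
    ext x
    rw [integral_indicator_one measurableSet_Iic]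
  rw [h, continuous_iff_continuousAt]
  intro x₀
  refine continuousAt_of_dominated (bound := fun _ => 1) ?_ ?_ (integrable_const _) ?_
  · exact Eventually.of_forall fun x =>
      (measurable_one.indicator measurableSet_Iic).aestronglyMeasurable
  · refine Eventually.of_forall fun x => Eventually.of_forall fun y => ?_
    by_cases hy : y ∈ Set.Iic x <;> simp [hy]
  · have h0 : ∀ᵐ y ∂ρ, y ≠ x₀ := by
      rw [ae_iff]
      simp
    filter_upwards [h0] with y hy
    rcases lt_or_gt_of_ne hy with hy | hy
    · refine continuousAt_const (y := (1 : ℝ)) |>.congr ?_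
      filter_upwards [eventually_gt_nhds hy] with x hx
      rw [Set.indicator_of_mem (Set.mem_Iic.2 hx.le)]
      rfl
    · refine continuousAt_const (y := (0 : ℝ)) |>.congr ?_
      filter_upwards [eventually_lt_nhds hy] with x hx
      rw [Set.indicator_of_notMem (by simpa using hx)]

/-- Intermediate value theorem. The two extreme values are excluded because they may be attained
only in the limit. -/
lemma exists_measureReal_Iic_eq {t : ℝ} (h0 : 0 < t) (h1 : t < ρ.real Set.univ) :
    ∃ x, ρ.real (Set.Iic x) = t := by
  have hbot : Tendsto (fun x => ρ.real (Set.Iic x)) atBot (𝓝 0) := by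
    have h2 : Tendsto (fun x => ρ.real (Set.Ici x)) atBot (𝓝 (ρ.real Set.univ)) :=
      (ENNReal.tendsto_toReal (measure_ne_top ρ _)).comp (tendsto_measure_Ici_atBot ρ)
    have h3 := h2.const_sub (ρ.real Set.univ)
    rw [sub_self] at h3
    refine h3.congr fun x => ?_
    rw [← measureReal_compl measurableSet_Ici, Set.compl_Ici]
    exact measureReal_congr Iio_ae_eq_Iic
  have htop : Tendsto (fun x => ρ.real (Set.Iic x)) atTop (𝓝 (ρ.real Set.univ)) :=
    (ENNReal.tendsto_toReal (measure_ne_top ρ _)).comp (tendsto_measure_Iic_atTop ρ)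
  obtain ⟨a, ha⟩ := (hbot.eventually (gt_mem_nhds h0)).exists
  obtain ⟨b, hb⟩ := (htop.eventually (lt_mem_nhds h1)).exists
  exact mem_range_of_exists_le_of_exists_ge (continuous_measureReal_Iic ρ) ⟨a, ha.le⟩ ⟨b, hb.le⟩

/-- The probability integral transform of an atomless measure is uniform. -/
lemma measureReal_setOf_measureReal_Iic_le {t : ℝ} (h0 : 0 ≤ t) :
    ρ.real {x | ρ.real (Set.Iic x) ≤ t} = min t (ρ.real Set.univ) := by
  rcases le_or_gt (ρ.real Set.univ) t with h1 | h1
  · rw [min_eq_right h1]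
    congr 1
    rw [Set.eq_univ_iff_forall]
    exact fun x => (measureReal_mono (Set.subset_univ _)).trans h1
  rw [min_eq_left h1.le]
  refine le_antisymm (le_of_forall_gt_imp_ge_of_dense fun s hs => ?_) ?_
  · rcases le_or_gt (ρ.real Set.univ) s with h2 | h2
    · exact (measureReal_mono (Set.subset_univ _)).trans h2
    obtain ⟨x, rfl⟩ := exists_measureReal_Iic_eq ρ (h0.trans_lt hs) h2
    refine measureReal_mono fun y hy => ?_
    by_contra hxy
    exact (hs.trans_le (monotone_measureReal_Iic ρ (not_le.1 hxy).le)).not_ge hy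
  · rcases h0.eq_or_lt with rfl | h0
    · exact measureReal_nonneg
    obtain ⟨x, rfl⟩ := exists_measureReal_Iic_eq ρ h0 h1
    exact measureReal_mono fun y hy => monotone_measureReal_Iic ρ hy

lemma map_measureReal_Iic_eq {ρ' : Measure ℝ} [IsFiniteMeasure ρ'] [NullSingletonClass ρ']
    (h : ρ.real Set.univ = ρ'.real Set.univ) :
    ρ.map (fun x => ρ.real (Set.Iic x)) = ρ'.map (fun x => ρ'.real (Set.Iic x)) := by
  refine Measure.ext_of_Iic _ _ fun t => ?_
  rw [Measure.map_apply (continuous_measureReal_Iic ρ).measurable measurableSet_Iic,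
    Measure.map_apply (continuous_measureReal_Iic ρ').measurable measurableSet_Iic,
    ← measureReal_eq_measureReal_iff]
  rcases lt_or_ge t 0 with ht | ht
  · have hempty : ∀ (ρ : Measure ℝ), (fun x => ρ.real (Set.Iic x)) ⁻¹' Set.Iic t = ∅ :=
      fun ρ => Set.eq_empty_of_forall_notMem fun x hx =>
        (ht.trans_le measureReal_nonneg).not_ge (Set.mem_Iic.1 hx)
    rw [hempty, hempty]
    simp
  · exact (measureReal_setOf_measureReal_Iic_le ρ ht).trans
      (h ▸ (measureReal_setOf_measureReal_Iic_le ρ' ht).symm)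

/-- By the uniform law, the distribution function is at most its value at `r` on a set of mass
exactly that of `Iic r`; nothing is left for the flat stretch to the right of `r`. -/
lemma measure_setOf_measureReal_Iic_eq (r : ℝ) :
    ρ {x | r < x ∧ ρ.real (Set.Iic r) = ρ.real (Set.Iic x)} = 0 := by
  rw [← measureReal_eq_zero_iff]
  have h1 : {x | ρ.real (Set.Iic x) ≤ ρ.real (Set.Iic r)} =
      Set.Iic r ∪ {x | r < x ∧ ρ.real (Set.Iic r) = ρ.real (Set.Iic x)} := by
    ext x
    simp only [Set.mem_ofPred_eq, Set.mem_union, Set.mem_Iic]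
    constructor
    · intro hx
      rcases le_or_gt x r with h | h
      · exact Or.inl h
      · exact Or.inr ⟨h, le_antisymm (monotone_measureReal_Iic ρ h.le) hx⟩
    · rintro (hx | hx)
      · exact monotone_measureReal_Iic ρ hx
      · exact hx.2.ge
  have h2 := measureReal_setOf_measureReal_Iic_le ρ (measureReal_nonneg (μ := ρ) (s := Set.Iic r))
  rw [min_eq_left (measureReal_mono (Set.subset_univ _)), h1, measureReal_union'
    (Set.disjoint_left.2 fun x hx hx' => hx'.1.not_ge hx) measurableSet_Iic] at h2
  linarith

end Atomless

/-! ## Isomorphisms matching two labels -/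

section Matching

/-- An almost everywhere injective measurable map on a standard Borel space is an isomorphism
modulo null sets onto its law. -/
lemma exists_modZeroIso_map_of_injOn {Y Z : Type*} [MeasurableSpace Y] [StandardBorelSpace Y]
    [Nonempty Y] [MeasurableSpace Z] [MeasurableSpace.CountablySeparated Z] {ν : Measure Y}
    {f : Y → Z} (hf : Measurable f) {s : Set Y} (hs : MeasurableSet s) (hν : ν sᶜ = 0)
    (hinj : Set.InjOn f s) :
    ∃ κ : ModZeroIso ν (ν.map f), κ.toFun = f := by
  -- Lusin–Souslin: an injective measurable image of a standard Borel set is measurable. This makes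
  -- the inverse measurable modulo null sets.
  have himg : ∀ t, MeasurableSet t → MeasurableSet (f '' (s ∩ t)) := fun t ht =>
    (hs.inter ht).image_of_measurable_injOn hf (hinj.mono Set.inter_subset_left)
  have hinv : ∀ y ∈ s, Function.invFunOn f s (f y) = y := hinj.leftInvOn_invFunOn
  have hfs : ν.map f (f '' s)ᶜ = 0 := by
    have := himg _ MeasurableSet.univ
    rw [Set.inter_univ] at this
    rw [Measure.map_apply hf this.compl]
    exact measure_mono_null (fun y hy hys => hy (Set.mem_image_of_mem f hys)) hν
  have hae : ∀ᵐ z ∂(ν.map f), z ∈ f '' s := by rwa [ae_iff]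
  have hsae : ∀ᵐ y ∂ν, y ∈ s := by rwa [ae_iff]
  have hpre : ∀ t, Function.invFunOn f s ⁻¹' t =ᵐ[ν.map f] f '' (s ∩ t) := by
    intro t
    filter_upwards [hae] with z hz
    obtain ⟨y, hy, rfl⟩ := hz
    refine propext ?_
    change Function.invFunOn f s (f y) ∈ t ↔ f y ∈ f '' (s ∩ t)
    rw [hinv y hy]
    constructor
    · exact fun h => ⟨y, ⟨hy, h⟩, rfl⟩
    · rintro ⟨y', ⟨hy', ht⟩, h⟩
      rwa [← hinj hy' hy h]
  refine ⟨{
    toFun := f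
    invFun := Function.invFunOn f s
    preserves_toFun := .of_measurePreserving ⟨hf, rfl⟩
    preserves_invFun := ⟨fun t ht => (himg t ht).nullMeasurableSet.congr (hpre t).symm,
      fun t ht => ?_⟩
    left_inv := ?_
    right_inv := ?_ }, rfl⟩
  · rw [measure_congr (hpre t), Measure.map_apply hf (himg t ht)]
    refine measure_congr ?_
    filter_upwards [hsae] with y hy
    refine propext ?_
    change f y ∈ f '' (s ∩ t) ↔ y ∈ t
    constructor
    · rintro ⟨y', ⟨hy', ht⟩, h⟩
      rwa [← hinj hy' hy h]
    · exact fun h => ⟨y, ⟨hy, h⟩, rfl⟩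
  · filter_upwards [hsae] with y hy using hinv y hy
  · filter_upwards [hae] with z hz
    exact Function.invFunOn_eq hz

/-- The label of a point together with its rank among the points that carry the same label. -/
noncomputable def labelRank {ι : Type*} (ν : Measure ℝ) (c : ℝ → ι) (x : ℝ) : ι × ℝ :=
  (c x, (ν.restrict (c ⁻¹' {c x})).real (Set.Iic x))

lemma labelRank_preimage_inter {ι : Type*} (ν : Measure ℝ) (c : ℝ → ι)
    (s : Set (ι × ℝ)) (i : ι) :
    labelRank ν c ⁻¹' s ∩ c ⁻¹' {i} =
      (fun x => (ν.restrict (c ⁻¹' {i})).real (Set.Iic x)) ⁻¹' (Prod.mk i ⁻¹' s) ∩ c ⁻¹' {i} := by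
  ext x
  simp only [Set.mem_inter_iff, Set.mem_preimage, Set.mem_singleton_iff, labelRank]
  constructor
  · rintro ⟨h, rfl⟩
    exact ⟨h, rfl⟩
  · rintro ⟨h, rfl⟩
    exact ⟨h, rfl⟩

variable {ι : Type*} [Fintype ι] [MeasurableSpace ι] [DiscreteMeasurableSpace ι]

variable {ν : Measure ℝ} [IsFiniteMeasure ν] [NullSingletonClass ν] {c : ℝ → ι}

lemma measurable_labelRank (hc : Measurable c) : Measurable (labelRank ν c) := by
  intro s hs
  have : labelRank ν c ⁻¹' s = ⋃ i, (labelRank ν c ⁻¹' s ∩ c ⁻¹' {i}) := by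
    rw [← Set.inter_iUnion, ← Set.preimage_iUnion, Set.iUnion_of_singleton, Set.preimage_univ,
      Set.inter_univ]
  rw [this]
  refine MeasurableSet.iUnion fun i => ?_
  rw [labelRank_preimage_inter]
  exact ((continuous_measureReal_Iic _).measurable (measurable_prodMk_left hs)).inter
    (hc (measurableSet_singleton i))

/-- Within a cell the rank is uniform on an interval whose length is the mass of the cell, so the
joint law of label and rank depends only on the cell masses. -/
lemma map_labelRank_eq {d : ℝ → ι} (hc : Measurable c) (hd : Measurable d)
    (h : ∀ i, ν.real (c ⁻¹' {i}) = ν.real (d ⁻¹' {i})) :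
    ν.map (labelRank ν c) = ν.map (labelRank ν d) := by
  ext s hs
  rw [Measure.map_apply (measurable_labelRank hc) hs, Measure.map_apply (measurable_labelRank hd) hs,
    ← measureReal_eq_measureReal_iff, measureReal_eq_sum_inter_preimage ν hc,
    measureReal_eq_sum_inter_preimage ν hd]
  refine Finset.sum_congr rfl fun i _ => ?_
  rw [labelRank_preimage_inter, labelRank_preimage_inter]
  have hsi : MeasurableSet (Prod.mk i ⁻¹' s) := measurable_prodMk_left hs
  have key := map_measureReal_Iic_eq (ν.restrict (c ⁻¹' {i})) (ρ' := ν.restrict (d ⁻¹' {i}))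
    (by rw [measureReal_restrict_apply .univ, measureReal_restrict_apply .univ,
      Set.univ_inter, Set.univ_inter, h i])
  have := congrArg (fun m => (m (Prod.mk i ⁻¹' s)).toReal) key
  beta_reduce at this
  rw [Measure.map_apply (continuous_measureReal_Iic _).measurable hsi,
    Measure.map_apply (continuous_measureReal_Iic _).measurable hsi,
    Measure.restrict_apply ((continuous_measureReal_Iic _).measurable hsi),
    Measure.restrict_apply ((continuous_measureReal_Iic _).measurable hsi)] at this
  exact this

/-- Two points of one cell share a rank only when the distribution function of the cell is flat
between them. A rational in between then places the larger point in the null set `N`. -/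
lemma exists_modZeroIso_labelRank (hc : Measurable c) :
    ∃ κ : ModZeroIso ν (ν.map (labelRank ν c)), κ.toFun = labelRank ν c := by
  set F : ι → ℝ → ℝ := fun i x => (ν.restrict (c ⁻¹' {i})).real (Set.Iic x) with hF
  set N : Set ℝ := {x | ∃ r : ℚ, (r : ℝ) < x ∧ F (c x) r = F (c x) x} with hN
  have hN0 : ν N = 0 := by
    have hsub : N ⊆ ⋃ i : ι, ⋃ r : ℚ, ({x : ℝ | (r : ℝ) < x ∧ F i r = F i x} ∩ c ⁻¹' {i}) := by
      rintro x ⟨r, hr⟩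
      exact Set.mem_iUnion₂.2 ⟨c x, r, hr, rfl⟩
    refine measure_mono_null hsub (measure_iUnion_null fun i => measure_iUnion_null fun r => ?_)
    exact Measure.measure_inter_eq_zero_of_restrict (measure_setOf_measureReal_Iic_eq _ _)
  refine exists_modZeroIso_map_of_injOn (measurable_labelRank hc)
    (measurableSet_toMeasurable ν N).compl (by rw [compl_compl, measure_toMeasurable, hN0]) ?_
  have hNc : ∀ x ∈ (toMeasurable ν N)ᶜ, x ∉ N := fun x hx h => hx (subset_toMeasurable ν N h)
  have key : ∀ x y, y ∉ N → x < y → labelRank ν c x ≠ labelRank ν c y := by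
    intro x y hy hxy heq
    obtain ⟨r, h1, h2⟩ := exists_rat_btwn hxy
    simp only [labelRank, Prod.mk.injEq] at heq
    obtain ⟨h3, h4⟩ := heq
    rw [h3] at h4
    refine hy ⟨r, h2, le_antisymm (monotone_measureReal_Iic _ h2.le) ?_⟩
    rw [hF]
    dsimp only
    rw [← h4]
    exact monotone_measureReal_Iic _ h1.le
  intro x hx y hy hxy
  rcases lt_trichotomy x y with h | h | h
  · exact absurd hxy (key x y (hNc y hy) h)
  · exact h
  · exact absurd hxy.symm (key y x (hNc x hx) h)

/-- Two labels with the same law are matched by an automorphism. -/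
lemma exists_invTransf_real_label_comp_eq {d : ℝ → ι} (hc : Measurable c) (hd : Measurable d)
    (h : ∀ i, ν.real (c ⁻¹' {i}) = ν.real (d ⁻¹' {i})) :
    ∃ σ : InvTransf ν, ∀ᵐ x ∂ν, d (σ.toFun x) = c x := by
  obtain ⟨κ, hκ⟩ := exists_modZeroIso_labelRank (ν := ν) hc
  obtain ⟨κ', hκ'⟩ : ∃ κ' : ModZeroIso ν (ν.map (labelRank ν c)), κ'.toFun = labelRank ν d := by
    rw [map_labelRank_eq hc hd h]
    exact exists_modZeroIso_labelRank hd
  refine ⟨κ.trans κ'.symm, ?_⟩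
  filter_upwards [κ.preserves_toFun.tendsto_ae.eventually κ'.right_inv] with x hx
  rw [hκ', hκ] at hx
  have := congrArg Prod.fst hx
  change d (κ'.invFun (κ.toFun x)) = c x
  rw [hκ]
  exact this

end Matching

/-! ## Sets with prescribed correlations -/

section Correlated

variable {X : Type*} [MeasurableSpace X]

/-- A measure without atoms carries a function that is uniformly distributed. -/
lemma exists_uniform (ρ : Measure X) [IsFiniteMeasure ρ] {g : X → ℝ} (hg : Measurable g)
    (h0 : ∀ r, ρ (g ⁻¹' {r}) = 0) :
    ∃ u : X → ℝ, Measurable u ∧ ∀ t, 0 ≤ t → ρ.real {x | u x ≤ t} = min t (ρ.real Set.univ) := by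
  have hatom : NullSingletonClass (ρ.map g) :=
    ⟨fun r => by rw [Measure.map_apply hg (measurableSet_singleton r), h0 r]⟩
  have hR := (continuous_measureReal_Iic (ρ.map g)).measurable
  refine ⟨fun x => (ρ.map g).real (Set.Iic (g x)), hR.comp hg, fun t ht => ?_⟩
  have := measureReal_setOf_measureReal_Iic_le (ρ.map g) ht
  rwa [map_measureReal_apply hg (measurableSet_le hR measurable_const),
    map_measureReal_apply hg .univ, Set.preimage_univ] at this

variable {μ : Measure X}

/-- The subset is a sublevel set of a function that is uniform for the restriction to `A`. -/
lemma exists_subset_measureReal_eq [IsFiniteMeasure μ] {g : X → ℝ} (hg : Measurable g)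
    (h0 : ∀ r, μ (g ⁻¹' {r}) = 0) {A : Set X} (hA : MeasurableSet A) {t : ℝ} (ht0 : 0 ≤ t)
    (ht : t ≤ μ.real A) : ∃ B ⊆ A, MeasurableSet B ∧ μ.real B = t := by
  obtain ⟨u, hu, hut⟩ := exists_uniform (μ.restrict A) hg
    fun r => Measure.absolutelyContinuous_of_le Measure.restrict_le_self (h0 r)
  have hm : MeasurableSet {x | u x ≤ t} := measurableSet_le hu measurable_const
  refine ⟨{x | u x ≤ t} ∩ A, Set.inter_subset_right, hm.inter hA, ?_⟩
  rw [← measureReal_restrict_apply hm, hut t ht0, measureReal_restrict_apply .univ,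
    Set.univ_inter, min_eq_left ht]

lemma exists_subset_symmDiff_le [IsFiniteMeasure μ] {g : X → ℝ} (hg : Measurable g)
    (h0 : ∀ r, μ (g ⁻¹' {r}) = 0) {Q A : Set X} (hQ : MeasurableSet Q) (hA : MeasurableSet A)
    (hAQ : A ⊆ Q) {t : ℝ} (ht0 : 0 ≤ t) (ht : t ≤ μ.real Q) :
    ∃ B ⊆ Q, MeasurableSet B ∧ μ.real B = t ∧ μ.real (B ∆ A) ≤ |μ.real A - t| := by
  rcases le_total t (μ.real A) with h | h
  · obtain ⟨B, hBA, hB, hBt⟩ := exists_subset_measureReal_eq hg h0 hA ht0 h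
    refine ⟨B, hBA.trans hAQ, hB, hBt, ?_⟩
    rw [Set.symmDiff_def, Set.sdiff_eq_empty.2 hBA, Set.empty_union, measureReal_sdiff hBA hB, hBt]
    exact le_abs_self _
  · obtain ⟨B, hBA, hB, hBt⟩ := exists_subset_measureReal_eq hg h0 (hQ.diff hA)
      (t := t - μ.real A) (by linarith) (by rw [measureReal_sdiff hAQ hA]; linarith)
    have hdisj : Disjoint A B := (Set.disjoint_sdiff_right (s := A) (t := Q)).mono_right hBA
    refine ⟨A ∪ B, Set.union_subset hAQ (hBA.trans Set.sdiff_subset), hA.union hB, ?_, ?_⟩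
    · rw [measureReal_union hdisj hB, hBt]
      ring
    · refine (measureReal_mono (s₂ := B) ?_).trans ?_
      · intro x hx
        simp only [Set.mem_symmDiff, Set.mem_union] at hx
        tauto
      · rw [hBt, abs_sub_comm]
        exact le_abs_self _

/-- The first point of `A` in the forward orbit; points whose orbit avoids `A` are fixed. -/
lemma exists_firstHit (S : X → X) (hS : MeasurePreserving S μ μ) {A : Set X}
    (hA : MeasurableSet A) (hhit : ∀ᵐ x ∂μ, ∃ m, S^[m] x ∈ A) :
    ∃ π : X → X, Measurable π ∧ μ.map π ≪ μ ∧ ∀ᵐ x ∂μ, x ∉ A → π (S x) = π x := by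
  classical
  have hex : ∀ x, ∃ m, S^[m] x ∈ A ∨ ∀ k, S^[k] x ∉ A := by
    intro x
    by_cases h : ∃ m, S^[m] x ∈ A
    · exact h.imp fun m hm => Or.inl hm
    · exact ⟨0, Or.inr (not_exists.1 h)⟩
  have hSm : ∀ m, Measurable (S^[m]) := fun m => hS.measurable.iterate m
  have hπ : Measurable fun x => S^[Nat.find (hex x)] x := by
    refine Measurable.find (p := fun m x => S^[m] x ∈ A ∨ ∀ k, S^[k] x ∉ A) hSm (fun m => ?_) hex
    have : {x | S^[m] x ∈ A ∨ ∀ k, S^[k] x ∉ A} = S^[m] ⁻¹' A ∪ ⋂ k, (S^[k] ⁻¹' A)ᶜ := by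
      ext x
      simp
    rw [this]
    exact (hSm m hA).union (MeasurableSet.iInter fun k => (hSm k hA).compl)
  refine ⟨_, hπ, ?_, ?_⟩
  · refine Measure.AbsolutelyContinuous.mk fun s hs hs0 => ?_
    rw [Measure.map_apply hπ hs]
    refine measure_mono_null (t := ⋃ m, S^[m] ⁻¹' s)
      (fun x hx => Set.mem_iUnion.2 ⟨_, hx⟩) (measure_iUnion_null fun m => ?_)
    rw [(hS.iterate m).measure_preimage hs.nullMeasurableSet, hs0]
  · filter_upwards [hhit] with x hx hxA
    have h0 : ¬ (S^[0] x ∈ A ∨ ∀ k, S^[k] x ∉ A) := by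
      rintro (h | h)
      · exact hxA h
      · exact hx.elim h
    have hiff : ∀ m, (S^[m + 1] x ∈ A ∨ ∀ k, S^[k] x ∉ A) ↔
        (S^[m] (S x) ∈ A ∨ ∀ k, S^[k] (S x) ∉ A) := by
      intro m
      rw [Function.iterate_succ_apply]
      refine or_congr_right ⟨fun h => (hx.elim h).elim, fun h k => ?_⟩
      cases k with
      | zero => exact hxA
      | succ k => exact h k
    have h1 : ∃ m, S^[m + 1] x ∈ A ∨ ∀ k, S^[k] x ∉ A :=
      (hex (S x)).imp fun m hm => (hiff m).2 hm
    have h2 : Nat.find (hex x) = Nat.find (hex (S x)) + 1 := by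
      rw [Nat.find_comp_succ (hex x) h1 h0]
      congr 1
      exact Nat.find_congr' (fun {m} => hiff m)
    rw [h2, Function.iterate_succ_apply]

variable [IsProbabilityMeasure μ] {T : X → X}

/-- Under a mixing transformation almost every orbit visits a given set of positive measure, along
any arithmetic progression of times. -/
lemma IsStrongMixing.ae_exists_iterate_mem (hT : IsStrongMixing T μ) {n : ℕ} (hn : 0 < n)
    {A : Set X} (hA : MeasurableSet A) (hA0 : 0 < μ.real A) :
    ∀ᵐ x ∂μ, ∃ m, (T^[n])^[m] x ∈ A := by
  set B : Set X := {x | ∀ m, (T^[n])^[m] x ∉ A} with hB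
  have hmeas : ∀ m, Measurable ((T^[n])^[m]) := fun m =>
    (hT.measurePreserving.iterate n).measurable.iterate m
  have hBm : MeasurableSet B := by
    have : B = ⋂ m, ((T^[n])^[m] ⁻¹' A)ᶜ := by
      ext x
      simp [hB]
    rw [this]
    exact MeasurableSet.iInter fun m => (hmeas m hA).compl
  have hsub : ∀ m, B ⊆ (T^[n])^[m] ⁻¹' B := by
    intro m x hx k
    rw [← Function.iterate_add_apply]
    exact hx _
  -- The set `B` of points that never visit `A` lies in its preimage, which has the same measure; so
  -- the preimage is `B` modulo null sets and still misses `A`. Mixing then forces `μ(A) μ(B) = 0`.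
  have hzero : ∀ m, μ.real (A ∩ (T^[n])^[m] ⁻¹' B) = 0 := by
    intro m
    have h1 : μ.real ((T^[n])^[m] ⁻¹' B \ B) = 0 := by
      rw [measureReal_sdiff (hsub m) hBm,
        ((hT.measurePreserving.iterate n).iterate m).measureReal_preimage hBm.nullMeasurableSet,
        sub_self]
    refine le_antisymm ((measureReal_mono ?_).trans h1.le) measureReal_nonneg
    rintro x ⟨hxA, hxB⟩
    exact ⟨hxB, fun hx => hx 0 hxA⟩
  have hlim := (hT.mixing A B hA hBm).comp
    (tendsto_id.const_mul_atTop' hn : Tendsto (fun m : ℕ => n * m) atTop atTop)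
  have hconst : (fun n : ℕ => |μ.real (A ∩ T^[n] ⁻¹' B) - μ.real A * μ.real B|) ∘
      (fun m : ℕ => n * m) = fun _ => |μ.real A * μ.real B| := by
    ext m
    simp only [Function.comp_apply, Function.iterate_mul, hzero, zero_sub, abs_neg]
  rw [hconst, tendsto_const_nhds_iff, abs_eq_zero, mul_eq_zero] at hlim
  have hB0 : μ.real B = 0 := hlim.resolve_left hA0.ne'
  rw [measureReal_eq_zero_iff] at hB0
  rw [ae_iff]
  convert hB0 using 2
  ext x
  simp [hB]

/-- A function of the first point of the `Tⁿ`-orbit in a small set `A` is `Tⁿ`-invariant outside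
`A`, hence up to an error `μ(A) ≤ δ`. The law of that first point is absolutely continuous, hence
again atomless along `g`, so the function can be made uniform. -/
lemma IsStrongMixing.exists_almost_invariant_uniform (hT : IsStrongMixing T μ) {g : X → ℝ}
    (hg : Measurable g) (h0 : ∀ r, μ (g ⁻¹' {r}) = 0) {n : ℕ} (hn : 0 < n) {δ : ℝ} (hδ : 0 < δ) :
    ∃ u : X → ℝ, Measurable u ∧
      (∀ t, 0 ≤ t → t ≤ 1 → μ.real {x | u x ≤ t} = t) ∧
      ∀ s t, 0 ≤ s → s ≤ 1 → 0 ≤ t → t ≤ 1 →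
        min s t - δ ≤ μ.real ({x | u x ≤ s} ∩ T^[n] ⁻¹' {x | u x ≤ t}) := by
  obtain ⟨A, -, hA, hAδ⟩ := exists_subset_measureReal_eq hg h0 (A := Set.univ) .univ
    (t := min δ 1) (by positivity) (by simp)
  have hhit := hT.ae_exists_iterate_mem hn hA (by rw [hAδ]; positivity)
  obtain ⟨π, hπ, hac, hinv⟩ := exists_firstHit (T^[n]) (hT.measurePreserving.iterate n) hA hhit
  have : IsProbabilityMeasure (μ.map π) := Measure.isProbabilityMeasure_map hπ.aemeasurable
  obtain ⟨u, hu, hut⟩ := exists_uniform (μ.map π) hg fun r => hac (h0 r)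
  have hdist : ∀ t, 0 ≤ t → t ≤ 1 → μ.real {x | u (π x) ≤ t} = t := by
    intro t ht0 ht1
    have := hut t ht0
    rwa [map_measureReal_apply hπ (measurableSet_le hu measurable_const), probReal_univ,
      min_eq_left ht1] at this
  refine ⟨u ∘ π, hu.comp hπ, hdist, fun s t hs0 hs1 ht0 ht1 => ?_⟩
  have h1 : {x | u (π x) ≤ min s t} ≤ᵐ[μ]
      (({x | u (π x) ≤ s} ∩ T^[n] ⁻¹' {x | u (π x) ≤ t}) ∪ A : Set X) := by
    filter_upwards [hinv] with x hx hxm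
    by_cases hxA : x ∈ A
    · exact Or.inr hxA
    · refine Or.inl ⟨le_trans hxm (min_le_left _ _), ?_⟩
      change u (π (T^[n] x)) ≤ t
      rw [hx hxA]
      exact le_trans hxm (min_le_right _ _)
  have h2 : μ.real {x | u (π x) ≤ min s t} ≤
      μ.real ({x | u (π x) ≤ s} ∩ T^[n] ⁻¹' {x | u (π x) ≤ t}) + μ.real A :=
    (ENNReal.toReal_mono (measure_ne_top _ _) (measure_mono_ae h1)).trans
      (measureReal_union_le _ _)
  rw [hdist _ (le_min hs0 ht0) ((min_le_left _ _).trans hs1), hAδ] at h2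
  have := min_le_left δ 1
  change min s t - δ ≤ μ.real ({x | u (π x) ≤ s} ∩ T^[n] ⁻¹' {x | u (π x) ≤ t})
  linarith

variable {ι : Type*} [Fintype ι] [MeasurableSpace ι] [DiscreteMeasurableSpace ι] {c : X → ι}

/-- `D` is the set where `u ∘ T^M` lies below the threshold of the current cell. The shift by a late
`M` makes `u` nearly independent of the cells at times `0` and `n`, while almost invariance gives
overlap about `min (θ i) (θ j)`. -/
lemma IsStrongMixing.exists_approx_correlated (hT : IsStrongMixing T μ) {g : X → ℝ}
    (hg : Measurable g) (h0 : ∀ r, μ (g ⁻¹' {r}) = 0) (hc : Measurable c) {θ : ι → ℝ}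
    (hθ0 : ∀ i, 0 ≤ θ i) (hθ1 : ∀ i, θ i ≤ 1) (N : ℕ) {δ : ℝ} (hδ : 0 < δ) :
    ∃ n ≥ N, ∃ D : Set X, MeasurableSet D ∧
      (∀ i, |μ.real (D ∩ c ⁻¹' {i}) - θ i * μ.real (c ⁻¹' {i})| ≤ δ) ∧
      ∑ i, ∑ j, μ.real (c ⁻¹' {i}) * μ.real (c ⁻¹' {j}) * min (θ i) (θ j) - δ ≤
        μ.real (D ∩ T^[n] ⁻¹' D) := by
  have hcm : ∀ i, MeasurableSet (c ⁻¹' {i}) := fun i => hc (measurableSet_singleton i)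
  obtain ⟨r, hr0, hrδ, hr⟩ : ∃ r : ℝ, 0 < r ∧ r ≤ δ ∧
      (Fintype.card ι : ℝ) * (Fintype.card ι * (3 * r)) ≤ δ := by
    refine ⟨δ / (3 * (Fintype.card ι : ℝ) ^ 2 + 1), by positivity,
      div_le_self hδ.le (by nlinarith [sq_nonneg (Fintype.card ι : ℝ)]), ?_⟩
    have : (Fintype.card ι : ℝ) * (Fintype.card ι * (3 * (δ / (3 * (Fintype.card ι : ℝ) ^ 2 + 1))))
        = δ * ((3 * (Fintype.card ι : ℝ) ^ 2) / (3 * (Fintype.card ι : ℝ) ^ 2 + 1)) := by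
      field_simp
    rw [this]
    refine mul_le_of_le_one_right hδ.le ?_
    rw [div_le_one (by positivity)]
    linarith
  -- The order matters: `n` separates the cells from each other, then `u` is built for this `n`, and
  -- only then `M` is chosen. Each of the three approximations costs `r` per pair of cells.
  obtain ⟨n, hn, hnN, hn0⟩ := ((eventually_all.2 fun i => eventually_all.2 fun j =>
    (hT.mixing _ _ (hcm i) (hcm j)).eventually (gt_mem_nhds hr0)).and
      ((eventually_ge_atTop N).and (eventually_gt_atTop 0))).exists
  obtain ⟨u, hu, hu1, hu2⟩ := hT.exists_almost_invariant_uniform hg h0 hn0 hr0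
  have hE : ∀ i, MeasurableSet {x | u x ≤ θ i} := fun i => measurableSet_le hu measurable_const
  have hTm : ∀ m, Measurable (T^[m]) := fun m => hT.measurePreserving.measurable.iterate m
  obtain ⟨M, hM1, hM2⟩ := ((eventually_all.2 fun i =>
    (hT.mixing _ _ (hcm i) (hE i)).eventually (gt_mem_nhds hr0)).and
      (eventually_all.2 fun i => eventually_all.2 fun j =>
        (hT.mixing _ _ ((hcm i).inter (hTm n (hcm j))) ((hE i).inter (hTm n (hE j)))).eventually
          (gt_mem_nhds hr0))).exists
  refine ⟨n, hnN, {x | u (T^[M] x) ≤ θ (c x)}, measurableSet_le (hu.comp (hTm M))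
    ((measurable_of_finite θ).comp hc), fun i => ?_, ?_⟩
  · have : {x | u (T^[M] x) ≤ θ (c x)} ∩ c ⁻¹' {i} = c ⁻¹' {i} ∩ T^[M] ⁻¹' {x | u x ≤ θ i} := by
      ext x
      simp only [Set.mem_inter_iff, Set.mem_preimage, Set.mem_singleton_iff]
      constructor
      · rintro ⟨h, rfl⟩
        exact ⟨rfl, h⟩
      · rintro ⟨rfl, h⟩
        exact ⟨h, rfl⟩
    have h1 := hM1 i
    rw [hu1 _ (hθ0 i) (hθ1 i)] at h1
    rw [this, mul_comm (θ i)]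
    exact h1.le.trans hrδ
  · rw [measureReal_eq_sum_inter_preimage μ (hc.prodMk (hc.comp (hTm n))), Fintype.sum_prod_type]
    have hterm : ∀ i j, μ.real (c ⁻¹' {i}) * μ.real (c ⁻¹' {j}) * min (θ i) (θ j) - 3 * r ≤
        μ.real ({x | u (T^[M] x) ≤ θ (c x)} ∩ T^[n] ⁻¹' {x | u (T^[M] x) ≤ θ (c x)} ∩
          (fun x => (c x, (c ∘ T^[n]) x)) ⁻¹' {(i, j)}) := by
      intro i j
      have hset : {x | u (T^[M] x) ≤ θ (c x)} ∩ T^[n] ⁻¹' {x | u (T^[M] x) ≤ θ (c x)} ∩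
          (fun x => (c x, (c ∘ T^[n]) x)) ⁻¹' {(i, j)} = (c ⁻¹' {i} ∩ T^[n] ⁻¹' (c ⁻¹' {j})) ∩
            T^[M] ⁻¹' ({x | u x ≤ θ i} ∩ T^[n] ⁻¹' {x | u x ≤ θ j}) := by
        ext x
        have hcomm : T^[n] (T^[M] x) = T^[M] (T^[n] x) := by
          rw [← Function.iterate_add_apply, ← Function.iterate_add_apply, add_comm]
        simp only [Set.mem_inter_iff, Set.mem_preimage, Set.mem_singleton_iff, Prod.mk.injEq,
          Function.comp_apply, Set.mem_ofPred_eq, hcomm]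
        constructor
        · rintro ⟨⟨h1, h2⟩, rfl, rfl⟩
          exact ⟨⟨rfl, rfl⟩, h1, h2⟩
        · rintro ⟨⟨rfl, rfl⟩, h1, h2⟩
          exact ⟨⟨h1, h2⟩, rfl, rfl⟩
      rw [hset]
      have h1 := (abs_lt.1 (hM2 i j)).1
      have h2 := (abs_lt.1 (hn i j)).1
      have h3 := hu2 _ _ (hθ0 i) (hθ1 i) (hθ0 j) (hθ1 j)
      set a := μ.real (c ⁻¹' {i} ∩ T^[n] ⁻¹' (c ⁻¹' {j}))
      set e := μ.real ({x | u x ≤ θ i} ∩ T^[n] ⁻¹' {x | u x ≤ θ j})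
      set b := μ.real (c ⁻¹' {i}) * μ.real (c ⁻¹' {j})
      have he0 : 0 ≤ e := measureReal_nonneg
      have he1 : e ≤ 1 := measureReal_le_one
      have hb0 : 0 ≤ b := mul_nonneg measureReal_nonneg measureReal_nonneg
      have hb1 : b ≤ 1 := mul_le_one₀ measureReal_le_one measureReal_nonneg measureReal_le_one
      have h4 : (b - r) * e ≤ a * e := mul_le_mul_of_nonneg_right (by linarith) he0
      have h5 : b * (min (θ i) (θ j) - r) ≤ b * e := mul_le_mul_of_nonneg_left h3 hb0
      have h6 : r * e ≤ r := mul_le_of_le_one_right hr0.le he1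
      have h7 : b * r ≤ r := mul_le_of_le_one_left hr0.le hb1
      linarith
    have hsum := Finset.sum_le_sum fun i (_ : i ∈ Finset.univ) =>
      Finset.sum_le_sum fun j (_ : j ∈ Finset.univ) => hterm i j
    simp only [Finset.sum_sub_distrib, Finset.sum_const, Finset.card_univ, nsmul_eq_mul] at hsum
    linarith

/-- A lower bound in product form, so that the double sum over pairs of cells becomes a square. -/
lemma min_mul_min_le {θ θ' : ℝ} (h0 : 0 ≤ θ) (h1 : θ ≤ 1) (h0' : 0 ≤ θ') (h1' : θ' ≤ 1) :
    min θ (1 - θ) * min θ' (1 - θ') ≤ min θ θ' - θ * θ' := by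
  rcases le_total θ θ' with h | h
  · rw [min_eq_left h]
    calc min θ (1 - θ) * min θ' (1 - θ') ≤ θ * (1 - θ') :=
          mul_le_mul (min_le_left _ _) (min_le_right _ _) (le_min h0' (by linarith)) h0
      _ = θ - θ * θ' := by ring
  · rw [min_eq_right h]
    calc min θ (1 - θ) * min θ' (1 - θ') ≤ (1 - θ) * θ' :=
          mul_le_mul (min_le_right _ _) (min_le_left _ _) (le_min h0' (by linarith)) (by linarith)
      _ = θ' - θ * θ' := by ring

/-- If the measurable set `C` is far from every union of cells of `c`, its parts in the cells can be
rearranged so that the resulting set is substantially correlated with itself at a late time. -/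
lemma IsStrongMixing.exists_correlated (hT : IsStrongMixing T μ) {g : X → ℝ}
    (hg : Measurable g) (h0 : ∀ r, μ (g ⁻¹' {r}) = 0) (hc : Measurable c) {C : Set X}
    (hC : MeasurableSet C) {ε : ℝ} (hε : 0 < ε)
    (hfar : ε ≤ ∑ i, min (μ.real (C ∩ c ⁻¹' {i})) (μ.real (Cᶜ ∩ c ⁻¹' {i}))) (N : ℕ) :
    ∃ n ≥ N, ∃ D : Set X, MeasurableSet D ∧
      (∀ i, μ.real (D ∩ c ⁻¹' {i}) = μ.real (C ∩ c ⁻¹' {i})) ∧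
      ε ^ 2 / 2 ≤ μ.real (D ∩ T^[n] ⁻¹' D) - μ.real D ^ 2 := by
  have hcm : ∀ i, MeasurableSet (c ⁻¹' {i}) := fun i => hc (measurableSet_singleton i)
  set m : ι → ℝ := fun i => μ.real (C ∩ c ⁻¹' {i}) with hm
  set p : ι → ℝ := fun i => μ.real (c ⁻¹' {i}) with hp
  have hp0 : ∀ i, 0 ≤ p i := fun i => measureReal_nonneg
  have hm0 : ∀ i, 0 ≤ m i := fun i => measureReal_nonneg
  have hmp : ∀ i, m i ≤ p i := fun i => measureReal_mono Set.inter_subset_right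
  have hcompl : ∀ i, μ.real (Cᶜ ∩ c ⁻¹' {i}) = p i - m i := by
    intro i
    have h1 := measureReal_inter_add_sdiff (μ := μ) (s := c ⁻¹' {i}) hC
    rw [Set.sdiff_eq, Set.inter_comm, Set.inter_comm _ Cᶜ] at h1
    linarith
  set θ : ι → ℝ := fun i => m i / p i with hθ
  have hθ0 : ∀ i, 0 ≤ θ i := fun i => div_nonneg (hm0 i) (hp0 i)
  have hθ1 : ∀ i, θ i ≤ 1 := fun i => div_le_one_of_le₀ (hmp i) (hp0 i)
  have hθp : ∀ i, θ i * p i = m i := by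
    intro i
    rcases (hp0 i).eq_or_lt with h | h
    · have : m i = 0 := le_antisymm (h ▸ hmp i) (hm0 i)
      rw [← h, this, mul_zero]
    · exact div_mul_cancel₀ _ h.ne'
  have hK : (0 : ℝ) < 2 * Fintype.card ι + 1 := by positivity
  -- One `r` is lost in the correlation of `D₀`; correcting its mass by at most `r` in each cell
  -- costs `2 * card ι * r`, since the set enters the correlation twice. The total is `ε ^ 2 / 2`.
  set r : ℝ := ε ^ 2 / 2 / (2 * Fintype.card ι + 1) with hr
  have hr0 : 0 < r := by positivity
  obtain ⟨n, hnN, D₀, hD₀, hD₁, hD₂⟩ := hT.exists_approx_correlated hg h0 hc hθ0 hθ1 N hr0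
  have hB := fun i => exists_subset_symmDiff_le (μ := μ) hg h0 (hcm i) (hD₀.inter (hcm i))
    Set.inter_subset_right (hm0 i) (hmp i)
  choose B hBsub hBm hBeq hBdiff using hB
  have hD : MeasurableSet (⋃ i, B i) := MeasurableSet.iUnion hBm
  have hcell : ∀ i, (⋃ j, B j) ∩ c ⁻¹' {i} = B i := by
    intro i
    ext x
    simp only [Set.mem_inter_iff, Set.mem_iUnion]
    constructor
    · rintro ⟨⟨j, hj⟩, hx⟩
      have h1 : c x = j := hBsub j hj
      have h2 : c x = i := hx
      rwa [← h2, h1]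
    · exact fun hx => ⟨⟨i, hx⟩, hBsub i hx⟩
  refine ⟨n, hnN, ⋃ i, B i, hD, fun i => by rw [hcell, hBeq], ?_⟩
  have hdiff : μ.real ((⋃ i, B i) ∆ D₀) ≤ Fintype.card ι * r := by
    rw [measureReal_eq_sum_inter_preimage μ hc, ← nsmul_eq_mul, ← Finset.card_univ]
    refine Finset.sum_le_card_nsmul _ _ _ fun i _ => ?_
    rw [Set.inter_symmDiff_distrib_right, hcell]
    refine (hBdiff i).trans ?_
    have := hD₁ i
    rwa [hθp i] at this
  have hcorr := (abs_le.1 (abs_measureReal_inter_preimage_sub_le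
    (hT.measurePreserving.iterate n) hD.nullMeasurableSet hD₀.nullMeasurableSet
    hD.nullMeasurableSet hD₀.nullMeasurableSet)).1
  have hDm : μ.real (⋃ i, B i) = ∑ i, m i := by
    rw [measureReal_eq_sum_inter_preimage μ hc]
    exact Finset.sum_congr rfl fun i _ => by rw [hcell, hBeq]
  have hgain : ε ^ 2 ≤ ∑ i, ∑ j, p i * p j * min (θ i) (θ j) - (∑ i, m i) ^ 2 := by
    have h1 : ε ^ 2 ≤ (∑ i, min (m i) (p i - m i)) ^ 2 := by
      simp only [hcompl] at hfar
      gcongr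
    refine h1.trans ?_
    rw [sq, sq, Finset.sum_mul_sum, Finset.sum_mul_sum, ← Finset.sum_sub_distrib]
    refine Finset.sum_le_sum fun i _ => ?_
    rw [← Finset.sum_sub_distrib]
    refine Finset.sum_le_sum fun j _ => ?_
    have h2 : ∀ i, min (m i) (p i - m i) = p i * min (θ i) (1 - θ i) := by
      intro i
      rw [mul_min_of_nonneg _ _ (hp0 i), mul_sub, mul_one, mul_comm, hθp]
    rw [h2, h2, ← hθp i, ← hθp j]
    have h3 := mul_le_mul_of_nonneg_left
      (min_mul_min_le (hθ0 i) (hθ1 i) (hθ0 j) (hθ1 j)) (mul_nonneg (hp0 i) (hp0 j))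
    linarith
  have hrK : r + 2 * (Fintype.card ι * r) = ε ^ 2 / 2 := by
    rw [hr]
    field_simp
    ring
  rw [hDm]
  linarith

end Correlated

/-! ## Convergence of functions with a common law -/

namespace PreservesModNull

variable {X Y : Type*} [MeasurableSpace X] [MeasurableSpace Y] {μ : Measure X} {ν : Measure Y}
  {f : X → Y} {k : Y → ℝ}

lemma aemeasurable_comp (hf : PreservesModNull f μ ν) (hk : AEMeasurable k ν) :
    AEMeasurable (k ∘ f) μ :=
  ((of_map_eq hk rfl : PreservesModNull k ν (ν.map k)).comp hf).nullMeasurable.aemeasurable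

lemma eLpNorm_comp (hf : PreservesModNull f μ ν) (hk : AEMeasurable k ν) :
    eLpNorm (k ∘ f) 1 μ = eLpNorm k 1 ν := by
  have h1 := ((of_map_eq hk rfl : PreservesModNull k ν (ν.map k)).comp hf).map_eq (hf.aemeasurable_comp hk)
  have h2 := eLpNorm_map_measure (p := 1) (g := id) aestronglyMeasurable_id hk
  have h3 := eLpNorm_map_measure (p := 1) (g := id) aestronglyMeasurable_id
    (hf.aemeasurable_comp hk)
  rw [h1] at h3
  exact h3.symm.trans h2

lemma memLp_comp (hf : PreservesModNull f μ ν) (hk : MemLp k 1 ν) : MemLp (k ∘ f) 1 μ :=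
  ⟨(hf.aemeasurable_comp hk.1.aemeasurable).aestronglyMeasurable,
    (hf.eLpNorm_comp hk.1.aemeasurable).trans_lt hk.2⟩

end PreservesModNull

section CommonLaw

variable {X : Type*} [MeasurableSpace X] {μ : Measure X} [IsFiniteMeasure μ]
  {f : ℕ → X → ℝ} {F : X → ℝ}

/-- Every subsequence has a further subsequence that converges almost everywhere, and dominated
convergence applies to it. -/
lemma tendsto_eLpNorm_boundedContinuous_comp (hf : ∀ n, AEStronglyMeasurable (f n) μ)
    (hF : AEStronglyMeasurable F μ)
    (hlim : Tendsto (fun n => eLpNorm (f n - F) 1 μ) atTop (𝓝 0))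
    (h : BoundedContinuousFunction ℝ ℝ) :
    Tendsto (fun n => eLpNorm (h ∘ f n - h ∘ F) 1 μ) atTop (𝓝 0) := by
  refine tendsto_of_subseq_tendsto fun ns hns => ?_
  obtain ⟨ms, -, hms⟩ := (tendstoInMeasure_of_tendsto_eLpNorm one_ne_zero (fun n => hf (ns n)) hF
    (hlim.comp hns)).exists_seq_tendsto_ae
  refine ⟨ms, ?_⟩
  have hcomp : ∀ {g : X → ℝ}, AEStronglyMeasurable g μ → AEStronglyMeasurable (h ∘ g) μ :=
    fun hg => h.continuous.comp_aestronglyMeasurable hg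
  simp only [eLpNorm_one_eq_lintegral_enorm]
  have := tendsto_lintegral_of_dominated_convergence' (μ := μ)
    (F := fun n x => ‖(h ∘ f (ns (ms n)) - h ∘ F) x‖ₑ) (f := fun _ => 0)
    (fun _ => ‖h‖ₑ + ‖h‖ₑ) (fun n => ((hcomp (hf _)).sub (hcomp hF)).enorm) (fun n => ?_) ?_ ?_
  · simpa using this
  · refine Eventually.of_forall fun x => ?_
    refine (enorm_sub_le).trans (add_le_add ?_ ?_) <;>
    · rw [enorm_le_iff_norm_le]
      exact h.norm_coe_le_norm _
  · rw [lintegral_const]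
    exact ENNReal.mul_ne_top (by finiteness) (measure_ne_top _ _)
  · filter_upwards [hms] with x hx
    have h1 : Tendsto (fun n => h (f (ns (ms n)) x) - h (F x)) atTop (𝓝 0) := by
      rw [← sub_self (h (F x))]
      exact ((h.continuous.tendsto _).comp hx).sub_const _
    have h2 := h1.enorm
    rwa [enorm_zero] at h2

variable {ν : Measure ℝ} [IsFiniteMeasure ν]

lemma map_eq_of_tendsto_eLpNorm (hf : ∀ n, PreservesModNull (f n) μ ν)
    (hF : AEStronglyMeasurable F μ)
    (hlim : Tendsto (fun n => eLpNorm (f n - F) 1 μ) atTop (𝓝 0)) : μ.map F = ν := by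
  have hfm : ∀ n, AEMeasurable (f n) μ := fun n => (hf n).nullMeasurable.aemeasurable
  refine ext_of_forall_integral_eq_of_IsFiniteMeasure fun h => ?_
  have hint : ∀ {g : X → ℝ}, AEStronglyMeasurable g μ → Integrable (h ∘ g) μ := fun hg =>
    Integrable.of_bound (C := ‖h‖) (h.continuous.comp_aestronglyMeasurable hg)
      (Eventually.of_forall fun x => h.norm_coe_le_norm _)
  have h1 : ∀ {g : X → ℝ}, AEMeasurable g μ → ∫ y, h y ∂(μ.map g) = ∫ x, (h ∘ g) x ∂μ :=
    fun hg => integral_map hg h.continuous.aestronglyMeasurable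
  rw [h1 hF.aemeasurable]
  have h2 := tendsto_integral_of_L1' (h ∘ F) (hint hF).1
    (Eventually.of_forall fun n => hint (hfm n).aestronglyMeasurable)
    (tendsto_eLpNorm_boundedContinuous_comp (fun n => (hfm n).aestronglyMeasurable) hF hlim h)
  simp only [← h1 (hfm _), (hf _).map_eq (hfm _)] at h2
  exact tendsto_nhds_unique h2 tendsto_const_nhds

/-- If functions with the same law converge in `L¹`, then so do their compositions with a function
that is integrable for that law. -/
lemma tendsto_eLpNorm_comp_of_law (hf : ∀ n, PreservesModNull (f n) μ ν)
    (hF : AEStronglyMeasurable F μ)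
    (hlim : Tendsto (fun n => eLpNorm (f n - F) 1 μ) atTop (𝓝 0)) {h : ℝ → ℝ}
    (hh : MemLp h 1 ν) :
    Tendsto (fun n => eLpNorm (h ∘ f n - h ∘ F) 1 μ) atTop (𝓝 0) := by
  have hfm : ∀ n, AEMeasurable (f n) μ := fun n => (hf n).nullMeasurable.aemeasurable
  have hFν := map_eq_of_tendsto_eLpNorm hf hF hlim
  have hfν : ∀ n, μ.map (f n) = ν := fun n => (hf n).map_eq (hfm n)
  rw [ENNReal.tendsto_nhds_zero]
  intro ε hε
  have hε3 : ε / 3 ≠ 0 := (ENNReal.div_pos hε.ne' (by norm_num)).ne'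
  -- Since all `f n` and `F` have law `ν`, replacing `h` by `h'` costs the same `L¹(ν)` error in
  -- every composition.
  obtain ⟨h', hh', -⟩ := hh.exists_boundedContinuous_eLpNorm_sub_le ENNReal.one_ne_top hε3
  have hmeas : ∀ {g : X → ℝ}, AEMeasurable g μ → μ.map g = ν →
      AEStronglyMeasurable (h ∘ g) μ ∧ AEStronglyMeasurable (h' ∘ g) μ ∧
        eLpNorm (h ∘ g - h' ∘ g) 1 μ ≤ ε / 3 := by
    intro g hg hgν
    have hgP := PreservesModNull.of_map_eq hg hgν
    exact ⟨(hgP.memLp_comp hh).1,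
      h'.continuous.comp_aestronglyMeasurable hg.aestronglyMeasurable,
      (hgP.eLpNorm_comp (hh.1.sub h'.continuous.aestronglyMeasurable).aemeasurable).trans_le hh'⟩
  filter_upwards [(ENNReal.tendsto_nhds_zero.1 (tendsto_eLpNorm_boundedContinuous_comp
    (fun n => (hfm n).aestronglyMeasurable) hF hlim h')) (ε / 3) (pos_iff_ne_zero.2 hε3)] with n hn
  obtain ⟨a1, a2, a3⟩ := hmeas (hfm n) (hfν n)
  obtain ⟨b1, b2, b3⟩ := hmeas hF.aemeasurable hFν
  have hdecomp : h ∘ f n - h ∘ F =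
      (h ∘ f n - h' ∘ f n) + ((h' ∘ f n - h' ∘ F) - (h ∘ F - h' ∘ F)) := by
    ext x
    simp
  rw [hdecomp]
  calc eLpNorm ((h ∘ f n - h' ∘ f n) + ((h' ∘ f n - h' ∘ F) - (h ∘ F - h' ∘ F))) 1 μ
      ≤ eLpNorm (h ∘ f n - h' ∘ f n) 1 μ +
          eLpNorm ((h' ∘ f n - h' ∘ F) - (h ∘ F - h' ∘ F)) 1 μ :=
        eLpNorm_add_le (a1.sub a2) ((a2.sub b2).sub (b1.sub b2)) le_rfl
    _ ≤ eLpNorm (h ∘ f n - h' ∘ f n) 1 μ +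
          (eLpNorm (h' ∘ f n - h' ∘ F) 1 μ + eLpNorm (h ∘ F - h' ∘ F) 1 μ) := by
        gcongr
        exact eLpNorm_sub_le (a2.sub b2) (b1.sub b2) le_rfl
    _ ≤ ε / 3 + (ε / 3 + ε / 3) := by gcongr
    _ = ε := by rw [← add_assoc, ENNReal.add_thirds]

end CommonLaw

/-! ## A complete pseudometric that refines the weak topology -/

section Coordinates

variable {X : Type*} [MeasurableSpace X] {μ : Measure X} {ν : Measure ℝ}

/-- The invertible transformations of `μ`, equipped with the distance in `L¹` between the coordinate
expressions of two transformations and of their inverses. -/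
def CoordTransf (_θ : ModZeroIso μ ν) (_hν : MemLp id 1 ν) := InvTransf μ

variable {θ : ModZeroIso μ ν} {hν : MemLp id 1 ν}

/-- The underlying invertible transformation. -/
def CoordTransf.toInvTransf (φ : CoordTransf θ hν) : InvTransf μ := φ

/-- The coordinate expressions of a transformation and of its inverse. -/
noncomputable def CoordTransf.coord (φ : CoordTransf θ hν) : Lp ℝ 1 μ × Lp ℝ 1 μ :=
  (((θ.preserves_toFun.comp (ModZeroIso.preserves_toFun φ)).memLp_comp hν).toLp
      (θ.toFun ∘ ModZeroIso.toFun φ),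
    ((θ.preserves_toFun.comp (ModZeroIso.preserves_invFun φ)).memLp_comp hν).toLp
      (θ.toFun ∘ ModZeroIso.invFun φ))

lemma CoordTransf.coord_fst_ae_eq (φ : CoordTransf θ hν) :
    φ.coord.1 =ᵐ[μ] θ.toFun ∘ ModZeroIso.toFun φ :=
  MemLp.coeFn_toLp ((θ.preserves_toFun.comp (ModZeroIso.preserves_toFun φ)).memLp_comp hν)

lemma CoordTransf.coord_snd_ae_eq (φ : CoordTransf θ hν) :
    φ.coord.2 =ᵐ[μ] θ.toFun ∘ ModZeroIso.invFun φ :=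
  MemLp.coeFn_toLp ((θ.preserves_toFun.comp (ModZeroIso.preserves_invFun φ)).memLp_comp hν)

noncomputable instance : PseudoMetricSpace (CoordTransf θ hν) :=
  PseudoMetricSpace.induced CoordTransf.coord inferInstance

lemma CoordTransf.isInducing_coord :
    IsInducing (CoordTransf.coord : CoordTransf θ hν → Lp ℝ 1 μ × Lp ℝ 1 μ) := ⟨rfl⟩

lemma CoordTransf.edist_eq (φ ψ : CoordTransf θ hν) :
    edist φ ψ = max
      (eLpNorm (θ.toFun ∘ φ.toInvTransf.toFun - θ.toFun ∘ ψ.toInvTransf.toFun) 1 μ)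
      (eLpNorm (θ.toFun ∘ φ.toInvTransf.invFun - θ.toFun ∘ ψ.toInvTransf.invFun) 1 μ) := by
  change edist φ.coord ψ.coord = _
  rw [Prod.edist_eq, coord, coord, Lp.edist_toLp_toLp, Lp.edist_toLp_toLp]
  rfl

lemma CoordTransf.tendsto_coord_iff {φ : ℕ → CoordTransf θ hν} {F : Lp ℝ 1 μ × Lp ℝ 1 μ} :
    Tendsto (fun n => (φ n).coord) atTop (𝓝 F) ↔
      Tendsto (fun n => eLpNorm (θ.toFun ∘ ModZeroIso.toFun (φ n) - (F.1 : X → ℝ)) 1 μ) atTop (𝓝 0) ∧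
      Tendsto (fun n => eLpNorm (θ.toFun ∘ ModZeroIso.invFun (φ n) - (F.2 : X → ℝ)) 1 μ) atTop (𝓝 0) := by
  rw [Prod.tendsto_iff, Lp.tendsto_Lp_iff_tendsto_eLpNorm', Lp.tendsto_Lp_iff_tendsto_eLpNorm']
  refine and_congr (iff_of_eq ?_) (iff_of_eq ?_) <;> congr 1 <;> ext n
  · exact eLpNorm_congr_ae ((φ n).coord_fst_ae_eq.sub EventuallyEq.rfl)
  · exact eLpNorm_congr_ae ((φ n).coord_snd_ae_eq.sub EventuallyEq.rfl)

variable [IsFiniteMeasure μ] [IsFiniteMeasure ν]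

/-- The composition of the limits of the two coordinate expressions is the identity. -/
lemma CoordTransf.limit_comp_ae_eq {φ : ℕ → CoordTransf θ hν} {F F' : X → ℝ}
    (hF : AEStronglyMeasurable F μ) (hF' : MemLp F' 1 μ)
    (h : Tendsto (fun n => eLpNorm (θ.toFun ∘ ModZeroIso.toFun (φ n) - F) 1 μ) atTop (𝓝 0))
    (h' : Tendsto (fun n => eLpNorm (θ.toFun ∘ ModZeroIso.invFun (φ n) - F') 1 μ) atTop (𝓝 0)) :
    (F' ∘ θ.invFun) ∘ F =ᵐ[μ] θ.toFun := by
  have hlaw : ∀ n, PreservesModNull (θ.toFun ∘ ModZeroIso.toFun (φ n)) μ ν := fun n =>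
    θ.preserves_toFun.comp (ModZeroIso.preserves_toFun (φ n))
  have hθm : AEMeasurable θ.toFun μ := θ.preserves_toFun.nullMeasurable.aemeasurable
  have hmem : MemLp (F' ∘ θ.invFun) 1 ν := θ.preserves_invFun.memLp_comp hF'
  have h1 := tendsto_eLpNorm_comp_of_law hlaw hF h hmem
  -- The change of variables `φ n` turns this distance into that between `F'` and the coordinate of
  -- the inverse of `φ n`.
  have h2 : Tendsto (fun n => eLpNorm ((F' ∘ θ.invFun) ∘ (θ.toFun ∘ ModZeroIso.toFun (φ n)) -
      θ.toFun) 1 μ) atTop (𝓝 0) := by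
    refine h'.congr fun n => ?_
    have hae : (F' ∘ θ.invFun) ∘ (θ.toFun ∘ ModZeroIso.toFun (φ n)) - θ.toFun =ᵐ[μ]
        (F' - θ.toFun ∘ ModZeroIso.invFun (φ n)) ∘ ModZeroIso.toFun (φ n) := by
      filter_upwards [(ModZeroIso.preserves_toFun (φ n)).tendsto_ae.eventually θ.left_inv,
        ModZeroIso.left_inv (φ n)] with x hx hx'
      simp only [Pi.sub_apply, Function.comp_apply, hx, hx']
    rw [eLpNorm_congr_ae hae, eLpNorm_sub_comm]
    exact ((ModZeroIso.preserves_toFun (φ n)).eLpNorm_comp (hF'.1.aemeasurable.sub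
      ((ModZeroIso.preserves_invFun (φ n)).aemeasurable_comp hθm))).symm
  have hFν := PreservesModNull.of_map_eq hF.aemeasurable (map_eq_of_tendsto_eLpNorm hlaw hF h)
  have hm1 := (hFν.memLp_comp hmem).1
  have h3 : eLpNorm ((F' ∘ θ.invFun) ∘ F - θ.toFun) 1 μ = 0 := by
    refine le_antisymm (ge_of_tendsto (by simpa using h1.add h2)
      (Eventually.of_forall fun n => ?_)) zero_le
    have hdecomp : (F' ∘ θ.invFun) ∘ F - θ.toFun =
        ((F' ∘ θ.invFun) ∘ (θ.toFun ∘ ModZeroIso.toFun (φ n)) - θ.toFun) -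
          ((F' ∘ θ.invFun) ∘ (θ.toFun ∘ ModZeroIso.toFun (φ n)) - (F' ∘ θ.invFun) ∘ F) := by
      ext x
      simp
    have hm2 := ((hlaw n).memLp_comp hmem).1
    rw [hdecomp, add_comm]
    exact eLpNorm_sub_le (hm2.sub hθm.aestronglyMeasurable) (hm2.sub hm1) le_rfl
  rw [eLpNorm_eq_zero_iff (hm1.sub hθm.aestronglyMeasurable) one_ne_zero] at h3
  filter_upwards [h3] with x hx
  exact sub_eq_zero.1 hx

/-- The coordinates of a Cauchy sequence converge in `L¹`. The limits keep the law `ν`, so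
`θ.invFun` turns them into measure-preserving maps of `X`; because the inverses converge too, these
two maps are inverse to each other. -/
instance : CompleteSpace (CoordTransf θ hν) := by
  refine Metric.complete_of_cauchySeq_tendsto fun φ hφ => ?_
  have hc : CauchySeq fun n => (φ n).coord := by
    rw [Metric.cauchySeq_iff'] at hφ ⊢
    exact hφ
  obtain ⟨⟨F, F'⟩, hF⟩ := cauchySeq_tendsto_of_complete hc
  obtain ⟨h1, h2⟩ := CoordTransf.tendsto_coord_iff.1 hF
  dsimp only at h1 h2
  have hFm : MemLp F 1 μ := Lp.memLp F
  have hFm' : MemLp F' 1 μ := Lp.memLp F'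
  have hP : PreservesModNull F μ ν := .of_map_eq hFm.1.aemeasurable
    (map_eq_of_tendsto_eLpNorm (fun n =>
      θ.preserves_toFun.comp (ModZeroIso.preserves_toFun (φ n))) hFm.1 h1)
  have hP' : PreservesModNull F' μ ν := .of_map_eq hFm'.1.aemeasurable
    (map_eq_of_tendsto_eLpNorm (fun n =>
      θ.preserves_toFun.comp (ModZeroIso.preserves_invFun (φ n))) hFm'.1 h2)
  have hcomp := CoordTransf.limit_comp_ae_eq hFm.1 hFm' h1 h2
  have hcomp' := CoordTransf.limit_comp_ae_eq (θ := θ) (hν := hν)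
    (φ := fun n => ModZeroIso.symm (φ n)) hFm'.1 hFm h2 h1
  let ψ : InvTransf μ :=
    { toFun := θ.invFun ∘ F
      invFun := θ.invFun ∘ F'
      preserves_toFun := θ.preserves_invFun.comp hP
      preserves_invFun := θ.preserves_invFun.comp hP'
      left_inv := by
        filter_upwards [hcomp, θ.left_inv] with x hx hx'
        simp only [Function.comp_apply] at hx ⊢
        rw [hx, hx']
      right_inv := by
        filter_upwards [hcomp', θ.left_inv] with x hx hx'
        simp only [Function.comp_apply] at hx ⊢
        rw [hx, hx'] }
  refine ⟨(ψ : CoordTransf θ hν), CoordTransf.isInducing_coord.tendsto_nhds_iff.2 ?_⟩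
  have hψ : CoordTransf.coord (θ := θ) (hν := hν) ψ = (F, F') := by
    refine Prod.ext (Lp.ext ?_) (Lp.ext ?_)
    · refine (CoordTransf.coord_fst_ae_eq (θ := θ) (hν := hν) ψ).trans ?_
      filter_upwards [hP.tendsto_ae.eventually θ.right_inv] with x hx using hx
    · refine (CoordTransf.coord_snd_ae_eq (θ := θ) (hν := hν) ψ).trans ?_
      filter_upwards [hP'.tendsto_ae.eventually θ.right_inv] with x hx using hx
  exact hψ ▸ hF

/-- The indicator of the image of `A` is a fixed `ν`-integrable function of the coordinate of the
inverse transformation, and these coordinates share the law `ν`. -/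
lemma CoordTransf.tendsto_measure_image_symmDiff {φ : ℕ → CoordTransf θ hν}
    {ψ : CoordTransf θ hν} (h : Tendsto φ atTop (𝓝 ψ)) {A : Set X} (hA : MeasurableSet A) :
    Tendsto (fun n => μ (InvTransf.image (φ n) A ∆ InvTransf.image ψ A)) atTop (𝓝 0) := by
  have hlim : Tendsto (fun n => eLpNorm (θ.toFun ∘ ModZeroIso.invFun (φ n) -
      θ.toFun ∘ ModZeroIso.invFun ψ) 1 μ) atTop (𝓝 0) := by
    rw [EMetric.tendsto_atTop] at h
    rw [ENNReal.tendsto_nhds_zero]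
    intro ε hε
    obtain ⟨N, hN⟩ := h ε hε
    filter_upwards [eventually_ge_atTop N] with n hn
    have := (hN n hn).le
    rw [CoordTransf.edist_eq] at this
    exact (le_max_right _ _).trans this
  have hB : NullMeasurableSet (θ.invFun ⁻¹' A) ν := θ.preserves_invFun.nullMeasurable hA
  have hh : MemLp ((θ.invFun ⁻¹' A).indicator fun _ => (1 : ℝ)) 1 ν := by
    obtain ⟨B, hBm, hBA⟩ := hB
    exact (memLp_indicator_const 1 hBm (1 : ℝ) (Or.inr (measure_ne_top _ _))).ae_eq
      (indicator_ae_eq_of_ae_eq_set hBA.symm)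
  have hψm : AEMeasurable (θ.toFun ∘ ModZeroIso.invFun ψ) μ :=
    (θ.preserves_toFun.comp (ModZeroIso.preserves_invFun ψ)).nullMeasurable.aemeasurable
  refine (tendsto_eLpNorm_comp_of_law (fun n =>
    θ.preserves_toFun.comp (ModZeroIso.preserves_invFun (φ n))) hψm.aestronglyMeasurable
    hlim hh).congr fun n => ?_
  have hind : ∀ κ : InvTransf μ, ((θ.invFun ⁻¹' A).indicator fun _ => (1 : ℝ)) ∘
      (θ.toFun ∘ κ.invFun) =ᵐ[μ] (InvTransf.image κ A).indicator fun _ => (1 : ℝ) := by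
    intro κ
    filter_upwards [κ.preserves_invFun.tendsto_ae.eventually θ.left_inv] with x hx
    change (θ.invFun ⁻¹' A).indicator (fun _ => (1 : ℝ)) (θ.toFun (κ.invFun x)) =
      (κ.invFun ⁻¹' A).indicator (fun _ => (1 : ℝ)) x
    classical
    rw [Set.indicator_apply, Set.indicator_apply]
    simp only [Set.mem_preimage, hx]
  have hnm : ∀ κ : InvTransf μ, NullMeasurableSet (InvTransf.image κ A) μ := fun κ =>
    κ.preserves_invFun.nullMeasurable hA
  have hnm2 : NullMeasurableSet (InvTransf.image (φ n) A ∆ InvTransf.image ψ A) μ :=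
    ((hnm _).diff (hnm _)).union ((hnm _).diff (hnm _))
  rw [eLpNorm_congr_ae ((hind (φ n)).sub (hind ψ)), eLpNorm_indicator_sub_indicator,
    eLpNorm_indicator_const₀ hnm2 one_ne_zero ENNReal.one_ne_top]
  simp

/-- The pseudometric topology refines the weak topology. -/
lemma CoordTransf.continuous_toInvTransf :
    Continuous (CoordTransf.toInvTransf : CoordTransf θ hν → InvTransf μ) := by
  refine continuous_generateFrom_iff.2 ?_
  rintro U ⟨φ, A, ε, hA, hε, rfl⟩
  rw [← isClosed_compl_iff]
  refine IsSeqClosed.isClosed fun u ψ hu huψ hψ => ?_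
  have hle : ∀ n, ε ≤ μ (InvTransf.image (u n) A ∆ InvTransf.image ψ A) +
      μ (InvTransf.image ψ A ∆ InvTransf.image φ A) := fun n =>
    (not_lt.1 (show ¬ μ (InvTransf.image (u n) A ∆ InvTransf.image φ A) < ε from hu n)).trans
      (measure_symmDiff_le _ _ _)
  have hlim := (CoordTransf.tendsto_measure_image_symmDiff huψ hA).add_const
    (μ (InvTransf.image ψ A ∆ InvTransf.image φ A))
  rw [zero_add] at hlim
  exact absurd hψ (not_lt.2 (ge_of_tendsto hlim (Eventually.of_forall hle)))

end Coordinates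

/-! ## Mixing Lebesgue spaces -/

section LebesgueSpace

variable {X : Type*} [MeasurableSpace X] {μ : Measure X}

lemma isTotallyBoundedFamily_of_measureReal_eq_zero_or_one [IsProbabilityMeasure μ]
    {𝒞 : Set (Set X)} (h : ∀ C ∈ 𝒞, μ.real C = 0 ∨ μ.real Cᶜ = 0) :
    IsTotallyBoundedFamily μ 𝒞 := by
  refine fun ε hε => ⟨1, fun _ => 0, measurable_const, fun C hC => ?_⟩
  rcases h C hC with h0 | h0
  · refine ⟨∅, ?_⟩
    rwa [Set.preimage_empty, ← Set.bot_eq_empty, symmDiff_bot, h0]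
  · refine ⟨Set.univ, ?_⟩
    rwa [Set.preimage_univ, ← Set.top_eq_univ, symmDiff_top, hnot_eq_compl, h0]

/-- A point of positive mass in a model of `μ` makes `μ` trivial, if `μ` carries a strong mixing
transformation. -/
lemma IsStrongMixing.measureReal_eq_zero_or_of_atom [IsProbabilityMeasure μ] {T : X → X}
    (hT : IsStrongMixing T μ) {Y : Type*} [MeasurableSpace Y] [MeasurableSingletonClass Y]
    {m : Measure Y} (θ : ModZeroIso μ m) {y : Y} (hy : m {y} ≠ 0) (E : Set X) :
    μ.real E = 0 ∨ μ.real Eᶜ = 0 := by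
  have hPn : NullMeasurableSet (θ.toFun ⁻¹' {y}) μ :=
    θ.preserves_toFun.nullMeasurable (measurableSet_singleton y)
  obtain ⟨A, hA, hPA⟩ := hPn
  have hA0 : μ.real A ≠ 0 := by
    rw [Ne, measureReal_eq_zero_iff, ← measure_congr hPA,
      θ.preserves_toFun.measure_preimage _ (measurableSet_singleton y)]
    exact hy
  -- Almost every point of `A` equals `θ.invFun y`, so `A` cannot be split.
  have hatom : ∀ B : Set X, μ (A ∩ B) = 0 ∨ μ (A \ B) = 0 := by
    intro B
    by_cases hB : θ.invFun y ∈ B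
    · right
      have : (A \ B : Set X) =ᵐ[μ] (∅ : Set X) := by
        filter_upwards [hPA, θ.left_inv] with x hx hx'
        refine propext ⟨fun h => ?_, fun h => h.elim⟩
        have h1 : θ.toFun x = y := hx.mpr h.1
        rw [h1] at hx'
        exact h.2 (hx' ▸ hB)
      rw [measure_congr this, measure_empty]
    · left
      have : (A ∩ B : Set X) =ᵐ[μ] (∅ : Set X) := by
        filter_upwards [hPA, θ.left_inv] with x hx hx'
        refine propext ⟨fun h => ?_, fun h => h.elim⟩
        have h1 : θ.toFun x = y := hx.mpr h.1
        rw [h1] at hx'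
        exact hB (hx' ▸ h.2)
      rw [measure_congr this, measure_empty]
  -- For late `n` the overlap of `A` with its preimage cannot vanish, as its limit is positive; by
  -- indivisibility it equals `μ(A)`. Hence `μ(A) = μ(A)²`.
  have hA1 : μ.real A = 1 := by
    have hpos : 0 < μ.real A * μ.real A := by positivity
    have hlim : Tendsto (fun n : ℕ => |μ.real (A ∩ T^[n] ⁻¹' A) - μ.real A * μ.real A|) atTop
        (𝓝 (|μ.real A - μ.real A * μ.real A|)) := by
      refine tendsto_const_nhds.congr' ?_
      filter_upwards [(tendsto_order.1 (hT.mixing A A hA hA)).2 _ hpos] with n hn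
      have hTA : MeasurableSet (T^[n] ⁻¹' A) := (hT.measurePreserving.iterate n).measurable hA
      have h1 := measureReal_inter_add_sdiff (μ := μ) (s := A) hTA
      rcases hatom (T^[n] ⁻¹' A) with h | h
      · rw [(measureReal_eq_zero_iff).2 h, zero_sub, abs_neg, abs_of_pos hpos] at hn
        exact absurd hn (lt_irrefl _)
      · rw [(measureReal_eq_zero_iff).2 h, add_zero] at h1
        rw [h1]
    have h2 := tendsto_nhds_unique (hT.mixing A A hA hA) hlim
    have h3 : μ.real A - μ.real A * μ.real A = 0 := abs_eq_zero.1 h2.symm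
    have h4 : μ.real A * (1 - μ.real A) = 0 := by linarith
    have h5 := (mul_eq_zero.1 h4).resolve_left hA0
    linarith
  have hAc : μ Aᶜ = 0 := by
    rw [← measureReal_eq_zero_iff, probReal_compl_eq_one_sub hA, hA1, sub_self]
  rcases hatom E with h | h
  · left
    rw [measureReal_eq_zero_iff]
    refine measure_mono_null (t := (A ∩ E) ∪ Aᶜ) (fun x hx => ?_) (measure_union_null h hAc)
    by_cases hxA : x ∈ A
    · exact Or.inl ⟨hxA, hx⟩
    · exact Or.inr hxA
  · right
    rw [measureReal_eq_zero_iff]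
    refine measure_mono_null (t := (A \ E) ∪ Aᶜ) (fun x hx => ?_) (measure_union_null h hAc)
    by_cases hxA : x ∈ A
    · exact Or.inl ⟨hxA, hx⟩
    · exact Or.inr hxA

/-- An atom would make every set null or conull, and such a family is totally bounded. Without
atoms, total mass one gives the interval length `1`. -/
lemma IsLebesgueSpace.exists_modZeroIso_Ico [IsProbabilityMeasure μ] (hL : IsLebesgueSpace μ)
    {T : X → X} (hT : IsStrongMixing T μ) {𝒞 : Set (Set X)}
    (h : ¬ IsTotallyBoundedFamily μ 𝒞) :
    ∃ θ : ModZeroIso μ (volume.restrict (Set.Ico (0 : ℝ) 1)), Measurable θ.toFun := by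
  obtain ⟨a, w, ⟨θ⟩⟩ := hL
  have hw : ∀ n, w n = 0 := by
    intro n
    by_contra hn
    refine h (isTotallyBoundedFamily_of_measureReal_eq_zero_or_one fun C _ =>
      hT.measureReal_eq_zero_or_of_atom θ (y := (n : ℝ) + 1) ?_ C)
    refine ((pos_iff_ne_zero.2 hn).trans_le ?_).ne'
    rw [Measure.add_apply, Measure.sum_apply _ (measurableSet_singleton _)]
    refine le_trans ?_ le_add_self
    refine le_trans ?_ (ENNReal.le_tsum n)
    simp
  have hzero : Measure.sum (fun n : ℕ => w n • Measure.dirac ((n : ℝ) + 1)) = 0 := by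
    simp [hw]
  rw [hzero, add_zero] at θ
  have ha : a = 1 := by
    have h1 := θ.preserves_toFun.measure_preimage Set.univ .univ
    rw [Set.preimage_univ, measure_univ, Measure.restrict_apply .univ, Set.univ_inter,
      Real.volume_Ico, sub_zero] at h1
    exact (ENNReal.ofReal_eq_one.1 h1.symm)
  subst ha
  have hm : AEMeasurable θ.toFun μ := θ.preserves_toFun.nullMeasurable.aemeasurable
  exact ⟨θ.congrToFun (hm.mk _) hm.ae_eq_mk, hm.measurable_mk⟩

/-- Two labels with the same law are matched by an automorphism. -/
lemma exists_invTransf_label_comp_eq {ν : Measure ℝ} [IsFiniteMeasure ν] [NullSingletonClass ν]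
    (θ : ModZeroIso μ ν) {ι : Type*} [Fintype ι] [MeasurableSpace ι] [DiscreteMeasurableSpace ι]
    {c d : X → ι} (hc : Measurable c) (hd : Measurable d)
    (h : ∀ i, μ.real (c ⁻¹' {i}) = μ.real (d ⁻¹' {i})) :
    ∃ σ : InvTransf μ, ∀ᵐ x ∂μ, d (σ.toFun x) = c x := by
  have hmk : ∀ {c : X → ι}, Measurable c → ∃ c' : ℝ → ι, Measurable c' ∧
      (∀ᵐ t ∂ν, c (θ.invFun t) = c' t) ∧ ∀ i, ν.real (c' ⁻¹' {i}) = μ.real (c ⁻¹' {i}) := by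
    intro c hc
    have hm : AEMeasurable (c ∘ θ.invFun) ν :=
      (hc.comp_nullMeasurable θ.preserves_invFun.nullMeasurable).aemeasurable
    refine ⟨hm.mk _, hm.measurable_mk, hm.ae_eq_mk, fun i => ?_⟩
    rw [← θ.preserves_invFun.measureReal_preimage (hc (measurableSet_singleton i)).nullMeasurableSet]
    exact measureReal_congr (hm.ae_eq_mk.symm.preimage {i})
  obtain ⟨c', hc', hcc', hcl⟩ := hmk hc
  obtain ⟨d', hd', hdd', hdl⟩ := hmk hd
  obtain ⟨σ, hσ⟩ := exists_invTransf_real_label_comp_eq (ν := ν) hc' hd'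
    (fun i => by rw [hcl, hdl, h])
  refine ⟨(θ.trans σ).trans θ.symm, ?_⟩
  have hθ := θ.preserves_toFun.tendsto_ae
  filter_upwards [hθ.eventually hσ, hθ.eventually hcc',
    (σ.preserves_toFun.comp θ.preserves_toFun).tendsto_ae.eventually hdd', θ.left_inv]
    with x h1 h2 h3 h4
  change d (θ.invFun (σ.toFun (θ.toFun x))) = c x
  rw [h4] at h2
  exact (h3.trans h1).trans h2.symm

end LebesgueSpace

/-! ## Conjugates with large late correlations -/

section Conjugates

variable {X : Type*} [MeasurableSpace X] {μ : Measure X} {T : X → X}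

lemma InvTransf.measureReal_image (φ : InvTransf μ) {A : Set X} (hA : MeasurableSet A) :
    μ.real (φ.image A) = μ.real A :=
  φ.preserves_invFun.measureReal_preimage hA.nullMeasurableSet

lemma InvTransf.nullMeasurableSet_image (φ : InvTransf μ) {A : Set X} (hA : MeasurableSet A) :
    NullMeasurableSet (φ.image A) μ :=
  φ.preserves_invFun.nullMeasurable hA

lemma conj_iterate_ae_eq (hT : MeasurePreserving T μ μ) (φ : InvTransf μ) (n : ℕ) :
    (conj T φ)^[n] =ᵐ[μ] φ.invFun ∘ T^[n] ∘ φ.toFun := by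
  induction n with
  | zero => exact φ.left_inv.mono fun x hx => hx.symm
  | succ n ih =>
    have h1 := ((hT.iterate n).quasiMeasurePreserving.tendsto_ae.comp
      φ.preserves_toFun.tendsto_ae).eventually φ.right_inv
    filter_upwards [ih, h1] with x hx hx'
    rw [Function.iterate_succ_apply', hx]
    simp only [conj, Function.comp_apply] at hx' ⊢
    rw [hx', Function.iterate_succ_apply']

lemma measureReal_inter_conj_preimage (hT : MeasurePreserving T μ μ) (φ : InvTransf μ) (n : ℕ)
    {C : Set X} (hC : MeasurableSet C) :
    μ.real (C ∩ (conj T φ)^[n] ⁻¹' C) = μ.real (φ.image C ∩ T^[n] ⁻¹' (φ.image C)) := by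
  have hn : NullMeasurableSet (φ.image C ∩ T^[n] ⁻¹' (φ.image C)) μ :=
    (φ.nullMeasurableSet_image hC).inter
      ((φ.nullMeasurableSet_image hC).preimage (hT.iterate n).quasiMeasurePreserving)
  rw [← φ.preserves_toFun.measureReal_preimage hn]
  refine measureReal_congr ?_
  rw [Set.preimage_inter]
  exact (φ.preimage_invFun_preimage_toFun C).symm.inter ((conj_iterate_ae_eq hT φ n).preimage C)

/-- The transformations `φ` for which some member of `𝒞`, transported by `φ`, is correlated with
itself by more than `a` at some time after `N`. -/
def lateCorrelated (μ : Measure X) (T : X → X) (𝒞 : Set (Set X)) (a : ℝ) (N : ℕ) :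
    Set (InvTransf μ) :=
  {φ | ∃ n ≥ N, ∃ C ∈ 𝒞, a < |μ.real (φ.image C ∩ T^[n] ⁻¹' (φ.image C)) - μ.real C ^ 2|}

variable {𝒞 : Set (Set X)}

/-- With the time and the set `C` kept fixed, the correlation changes by at most twice the measure
by which the image of `C` moves. -/
lemma isOpen_lateCorrelated [IsFiniteMeasure μ] (hT : MeasurePreserving T μ μ)
    (h𝒞 : ∀ C ∈ 𝒞, MeasurableSet C) (a : ℝ) (N : ℕ) : IsOpen (lateCorrelated μ T 𝒞 a N) := by
  rw [isOpen_iff_forall_mem_open]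
  rintro φ ⟨n, hn, C, hC, ha⟩
  set s := |μ.real (φ.image C ∩ T^[n] ⁻¹' (φ.image C)) - μ.real C ^ 2| - a with hs
  have hs0 : 0 < s := sub_pos.2 ha
  refine ⟨{ψ | μ (ψ.image C ∆ φ.image C) < ENNReal.ofReal (s / 2)}, fun ψ hψ => ?_,
    TopologicalSpace.isOpen_generateFrom_of_mem
      ⟨φ, C, _, h𝒞 C hC, ENNReal.ofReal_pos.2 (half_pos hs0), rfl⟩, ?_⟩
  · refine ⟨n, hn, C, hC, ?_⟩
    have h1 : μ.real (ψ.image C ∆ φ.image C) < s / 2 :=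
      (ENNReal.lt_ofReal_iff_toReal_lt (measure_ne_top _ _)).1 hψ
    have hφn := φ.nullMeasurableSet_image (h𝒞 C hC)
    have hψn := ψ.nullMeasurableSet_image (h𝒞 C hC)
    have h2 := abs_measureReal_inter_preimage_sub_le (hT.iterate n) hψn hφn hψn hφn
    have h3 := abs_sub_abs_le_abs_sub (μ.real (φ.image C ∩ T^[n] ⁻¹' (φ.image C)) - μ.real C ^ 2)
      (μ.real (ψ.image C ∩ T^[n] ⁻¹' (ψ.image C)) - μ.real C ^ 2)
    rw [sub_sub_sub_cancel_right, abs_sub_comm (μ.real (φ.image C ∩ T^[n] ⁻¹' (φ.image C)))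
      (μ.real (ψ.image C ∩ T^[n] ⁻¹' (ψ.image C)))] at h3
    linarith
  · change μ (φ.image C ∆ φ.image C) < _
    rw [symmDiff_self, Set.bot_eq_empty, measure_empty]
    exact ENNReal.ofReal_pos.2 (half_pos hs0)

lemma invFun_ae_eq_of_toFun_ae_eq {φ ψ : InvTransf μ} (h : φ.toFun =ᵐ[μ] ψ.toFun) :
    φ.invFun =ᵐ[μ] ψ.invFun := by
  filter_upwards [φ.right_inv, φ.preserves_invFun.tendsto_ae.eventually h,
    φ.preserves_invFun.tendsto_ae.eventually ψ.left_inv] with y h1 h2 h3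
  rw [← h3, ← h2, h1]

/-- Saturation under almost everywhere equality, which lets these sets descend to open sets of
`TransfSpace`. -/
lemma mem_lateCorrelated_of_ae_eq (hT : MeasurePreserving T μ μ) {a : ℝ} {N : ℕ}
    {φ ψ : InvTransf μ} (h : φ.toFun =ᵐ[μ] ψ.toFun) (hφ : φ ∈ lateCorrelated μ T 𝒞 a N) :
    ψ ∈ lateCorrelated μ T 𝒞 a N := by
  obtain ⟨n, hn, C, hC, ha⟩ := hφ
  refine ⟨n, hn, C, hC, ?_⟩
  have himg : φ.image C =ᵐ[μ] ψ.image C := (invFun_ae_eq_of_toFun_ae_eq h).preimage C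
  rwa [measureReal_congr (himg.inter
    ((hT.iterate n).quasiMeasurePreserving.preimage_ae_eq himg))] at ha

/-- The index of the interval of length `1 / M` in which a number in `[0, 1)` lies. -/
noncomputable def level (M : ℕ) (t : ℝ) : Fin (M + 1) := Fin.ofNat (M + 1) ⌊M * t⌋₊

lemma measurable_level (M : ℕ) : Measurable (level M) :=
  (measurable_from_nat (f := Fin.ofNat (M + 1))).comp
    (Nat.measurable_floor.comp (measurable_const.mul measurable_id))

lemma abs_sub_le_of_level_eq {M : ℕ} (hM : 0 < M) {s t : ℝ} (hs : s ∈ Set.Ico (0 : ℝ) 1)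
    (ht : t ∈ Set.Ico (0 : ℝ) 1) (h : level M s = level M t) : |s - t| ≤ 1 / M := by
  have hM' : (0 : ℝ) < M := by exact_mod_cast hM
  have hval : ∀ {r : ℝ}, r ∈ Set.Ico (0 : ℝ) 1 → (level M r : ℕ) = ⌊M * r⌋₊ := by
    intro r hr
    simp only [level, Fin.val_ofNat]
    refine Nat.mod_eq_of_lt (Nat.lt_succ_of_le (Nat.floor_le_of_le ?_))
    exact mul_le_of_le_one_right hM'.le hr.2.le
  have h1 : ⌊M * s⌋₊ = ⌊M * t⌋₊ := by rw [← hval hs, ← hval ht, h]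
  have hs1 := Nat.floor_le (mul_nonneg hM'.le hs.1)
  have hs2 := Nat.lt_floor_add_one (M * s)
  have ht1 := Nat.floor_le (mul_nonneg hM'.le ht.1)
  have ht2 := Nat.lt_floor_add_one (M * t)
  rw [h1] at hs1 hs2
  rw [abs_le, neg_le, le_div_iff₀ hM', le_div_iff₀ hM']
  constructor <;> linarith

variable {θ : ModZeroIso μ (volume.restrict (Set.Ico (0 : ℝ) 1))}
  {hν : MemLp id 1 (volume.restrict (Set.Ico (0 : ℝ) 1))}

lemma dense_lateCorrelated [IsProbabilityMeasure μ] (hT : IsStrongMixing T μ)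
    (h𝒞 : ∀ C ∈ 𝒞, MeasurableSet C) (hθ : Measurable θ.toFun) {ε : ℝ} (hε : 0 < ε)
    (hfar : ∀ (ι : Type) [Fintype ι] [MeasurableSpace ι] [DiscreteMeasurableSpace ι] (c : X → ι),
      Measurable c → ∃ C ∈ 𝒞, ∀ V : Set ι, ε ≤ μ.real (C ∆ (c ⁻¹' V))) (N : ℕ) :
    Dense ((CoordTransf.toInvTransf : CoordTransf θ hν → InvTransf μ) ⁻¹'
      lateCorrelated μ T 𝒞 (ε ^ 2 / 4) N) := by
  rw [EMetric.dense_iff]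
  intro φ₀' r hr
  set φ₀ : InvTransf μ := φ₀'.toInvTransf with hφ₀
  obtain ⟨M, hM, hMr⟩ : ∃ M : ℕ, 0 < M ∧ ENNReal.ofReal (1 / M) < r := by
    have hlim : Tendsto (fun M : ℕ => ENNReal.ofReal (1 / M)) atTop (𝓝 0) := by
      have := ENNReal.tendsto_ofReal (tendsto_one_div_atTop_nhds_zero_nat (𝕜 := ℝ))
      rwa [ENNReal.ofReal_zero] at this
    obtain ⟨M, h1, h2⟩ := ((eventually_gt_atTop 0).and (hlim.eventually (gt_mem_nhds hr))).exists
    exact ⟨M, h1, h2⟩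
  have hIco : ∀ᵐ x ∂μ, θ.toFun x ∈ Set.Ico (0 : ℝ) 1 :=
    θ.preserves_toFun.tendsto_ae.eventually (ae_restrict_mem measurableSet_Ico)
  have hwm : AEMeasurable (θ.toFun ∘ φ₀.invFun) μ :=
    (θ.preserves_toFun.comp φ₀.preserves_invFun).nullMeasurable.aemeasurable
  set w := hwm.mk _ with hw
  have hw_ae : θ.toFun ∘ φ₀.invFun =ᵐ[μ] w := hwm.ae_eq_mk
  -- An automorphism that preserves the first component moves points by at most `1 / M` in the
  -- coordinate, which controls `φ₀`; preserving the second component controls its inverse.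
  set c : X → Fin (M + 1) × Fin (M + 1) := fun y => (level M (θ.toFun y), level M (w y)) with hcdef
  have hc : Measurable c := ((measurable_level M).comp hθ).prodMk
    ((measurable_level M).comp hwm.measurable_mk)
  have hc₀m : AEMeasurable (c ∘ φ₀.toFun) μ :=
    (hc.comp_nullMeasurable φ₀.preserves_toFun.nullMeasurable).aemeasurable
  -- Distance from the label pulled back by `φ₀` is what makes the image `C'` of `C` far from the
  -- cells of `c` itself.
  obtain ⟨C, hC, hCV⟩ := hfar _ (hc₀m.mk _) hc₀m.measurable_mk
  have hCm := h𝒞 C hC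
  obtain ⟨C', hC', hCC'⟩ := φ₀.nullMeasurableSet_image hCm
  have hCfar : ε ≤ ∑ i, min (μ.real (C' ∩ c ⁻¹' {i})) (μ.real (C'ᶜ ∩ c ⁻¹' {i})) := by
    obtain ⟨V, hV⟩ := exists_symmDiff_preimage_le_sum_min μ hc C'
    refine (hCV V).trans (le_trans (le_of_eq ?_) hV)
    have hVm : MeasurableSet (c ⁻¹' V) := hc .of_discrete
    rw [← φ₀.preserves_toFun.measureReal_preimage (hC'.symmDiff hVm).nullMeasurableSet]
    refine measureReal_congr ?_
    have h1 : φ₀.toFun ⁻¹' C' =ᵐ[μ] C :=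
      (φ₀.preserves_toFun.preimage_ae_eq hCC'.symm).trans (φ₀.preimage_invFun_preimage_toFun C)
    exact h1.symm.symmDiff (hc₀m.ae_eq_mk.symm.preimage V)
  obtain ⟨n, hn, D, hD, hDc, hDcorr⟩ := hT.exists_correlated hθ (fun t => by
    rw [θ.preserves_toFun.measure_preimage _ (measurableSet_singleton t), measure_singleton])
    hc hC' hε hCfar N
  classical
  have hlab : ∀ {E : Set X}, MeasurableSet E →
      Measurable fun x => (c x, decide (x ∈ E)) := fun hE =>
    hc.prodMk (measurable_to_bool (by convert hE using 1; ext x; simp))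
  have htrue : ∀ (E : Set X) i, (fun x => (c x, decide (x ∈ E))) ⁻¹' {(i, true)} =
      E ∩ c ⁻¹' {i} := by
    intro E i
    ext x
    simp [and_comm]
  have hfalse : ∀ (E : Set X) i, (fun x => (c x, decide (x ∈ E))) ⁻¹' {(i, false)} =
      c ⁻¹' {i} \ E := by
    intro E i
    ext x
    simp
  -- Matching the label enlarged by membership in `C'`, respectively `D`, makes `σ` preserve the
  -- cells and carry `C'` onto `D` at once.
  obtain ⟨σ, hσ⟩ := exists_invTransf_label_comp_eq θ (hlab hC') (hlab hD) (by
    rintro ⟨i, b⟩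
    cases b with
    | true => rw [htrue, htrue, hDc]
    | false =>
      have h1 := measureReal_inter_add_sdiff (μ := μ) (s := c ⁻¹' {i}) hC'
      have h2 := measureReal_inter_add_sdiff (μ := μ) (s := c ⁻¹' {i}) hD
      have h3 := hDc i
      rw [Set.inter_comm] at h1 h2
      rw [hfalse, hfalse]
      linarith)
  have hσc : ∀ᵐ x ∂μ, c (σ.toFun x) = c x := hσ.mono fun x hx => congrArg Prod.fst hx
  have hσD : σ.toFun ⁻¹' D =ᵐ[μ] C' := hσ.mono fun x hx =>
    propext (decide_eq_decide.1 (congrArg Prod.snd hx))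
  obtain ⟨ψ, hψ⟩ : ∃ ψ : CoordTransf θ hν, ψ.toInvTransf = φ₀.trans σ := ⟨_, rfl⟩
  have himg : ψ.toInvTransf.image C =ᵐ[μ] D :=
    hψ ▸ (σ.preserves_invFun.preimage_ae_eq (hCC'.trans hσD.symm)).trans
      (σ.preimage_toFun_preimage_invFun D)
  refine ⟨ψ, ?_, n, hn, C, hC, ?_⟩
  · have hbound : ∀ {f g : X → ℝ}, (∀ᵐ x ∂μ, |f x - g x| ≤ 1 / M) →
        eLpNorm (f - g) 1 μ ≤ ENNReal.ofReal (1 / M) := by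
      intro f g hfg
      have := eLpNorm_le_of_ae_bound (p := 1) (f := f - g) hfg
      simpa using this
    refine lt_of_le_of_lt ?_ hMr
    rw [CoordTransf.edist_eq, hψ]
    refine max_le (hbound ?_) (hbound ?_)
    · have hφt := φ₀.preserves_toFun.tendsto_ae
      filter_upwards [hφt.eventually hσc, hφt.eventually hIco,
        (σ.preserves_toFun.comp φ₀.preserves_toFun).tendsto_ae.eventually hIco] with x h1 h2 h3
      exact abs_sub_le_of_level_eq hM h3 h2 (congrArg Prod.fst h1)
    · have hσt := σ.preserves_invFun.tendsto_ae
      have hφt := φ₀.preserves_invFun.tendsto_ae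
      filter_upwards [hσt.eventually hσc, σ.right_inv, hw_ae, hσt.eventually hw_ae,
        hφt.eventually hIco, hσt.eventually (hφt.eventually hIco)] with y h1 h2 h3 h4 h5 h6
      refine abs_sub_le_of_level_eq hM h6 h5 ?_
      rw [h2] at h1
      have h7 : level M (w y) = level M (w (σ.invFun y)) := congrArg Prod.snd h1
      rw [← h3, ← h4] at h7
      exact h7.symm
  · have h1 : μ.real C = μ.real D := by
      rw [← ψ.toInvTransf.measureReal_image hCm, measureReal_congr himg]
    rw [measureReal_congr (himg.inter
      ((hT.measurePreserving.iterate n).quasiMeasurePreserving.preimage_ae_eq himg)), h1]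
    refine lt_of_lt_of_le ?_ (hDcorr.trans (le_abs_self _))
    have : 0 < ε ^ 2 := by positivity
    linarith

lemma TransfSpace.continuous_mk : Continuous (TransfSpace.mk : InvTransf μ → TransfSpace μ) :=
  continuous_coinduced_rng

lemma TransfSpace.mk_surjective :
    Function.Surjective (TransfSpace.mk : InvTransf μ → TransfSpace μ) :=
  Quotient.mk_surjective

lemma preimage_mk_image_lateCorrelated (hT : MeasurePreserving T μ μ) (a : ℝ) (N : ℕ) :
    TransfSpace.mk ⁻¹' (TransfSpace.mk '' lateCorrelated μ T 𝒞 a N) = lateCorrelated μ T 𝒞 a N := by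
  refine Set.Subset.antisymm ?_ (Set.subset_preimage_image _ _)
  rintro φ ⟨ψ, hψ, h⟩
  exact mem_lateCorrelated_of_ae_eq hT (Quotient.exact h) hψ

theorem exists_dense_isGδ_forall_limsup_pos [IsProbabilityMeasure μ] (hT : IsStrongMixing T μ)
    (h𝒞 : ∀ C ∈ 𝒞, MeasurableSet C) (hL : IsLebesgueSpace μ)
    (h : ¬ IsTotallyBoundedFamily μ 𝒞) :
    ∃ G : Set (TransfSpace μ), IsGδ G ∧ Dense G ∧
      ∀ φ : InvTransf μ, TransfSpace.mk φ ∈ G →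
        0 < limsup (fun n : ℕ => ⨆ C ∈ 𝒞,
          ENNReal.ofReal |μ.real (C ∩ (conj T φ)^[n] ⁻¹' C) - μ.real C ^ 2|) atTop := by
  obtain ⟨θ, hθ⟩ := hL.exists_modZeroIso_Ico hT h
  obtain ⟨ε, hε, hfar⟩ := exists_far_of_not_isTotallyBoundedFamily h
  have hTm := hT.measurePreserving
  set U : ℕ → Set (InvTransf μ) := lateCorrelated μ T 𝒞 (ε ^ 2 / 4) with hU
  have hν : MemLp id 1 (volume.restrict (Set.Ico (0 : ℝ) 1)) := by
    refine MemLp.of_bound aestronglyMeasurable_id 1 ?_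
    filter_upwards [ae_restrict_mem measurableSet_Ico] with t ht
    rw [id, Real.norm_eq_abs, abs_of_nonneg ht.1]
    exact ht.2.le
  have hcont := CoordTransf.continuous_toInvTransf (θ := θ) (hν := hν)
  have hdense : Dense (⋂ N, (CoordTransf.toInvTransf : CoordTransf θ hν → InvTransf μ) ⁻¹' U N) :=
    dense_iInter_of_isOpen_nat
      (fun N => (isOpen_lateCorrelated hTm h𝒞 _ N).preimage hcont)
      (fun N => dense_lateCorrelated hT h𝒞 hθ hε hfar N)
  refine ⟨⋂ N, TransfSpace.mk '' U N, ?_, ?_, fun φ hφ => ?_⟩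
  · refine IsGδ.iInter_of_isOpen fun N => isOpen_coinduced.2 ?_
    rw [preimage_mk_image_lateCorrelated hTm]
    exact isOpen_lateCorrelated hTm h𝒞 _ N
  · have hsurj : Function.Surjective (TransfSpace.mk ∘
        (CoordTransf.toInvTransf : CoordTransf θ hν → InvTransf μ)) := TransfSpace.mk_surjective
    -- Density passes from the complete pseudometric space to the quotient along a continuous
    -- surjection.
    refine (hsurj.denseRange.dense_image (TransfSpace.continuous_mk.comp hcont) hdense).mono ?_
    rintro _ ⟨φ, hφ, rfl⟩
    exact Set.mem_iInter.2 fun N => Set.mem_image_of_mem _ (Set.mem_iInter.1 hφ N)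
  · have hpos : 0 < ENNReal.ofReal (ε ^ 2 / 4) := ENNReal.ofReal_pos.2 (by positivity)
    refine hpos.trans_le (le_limsup_of_frequently_le ?_ (by isBoundedDefault))
    rw [frequently_atTop]
    intro N
    have hφN : φ ∈ U N := by
      have := Set.mem_iInter.1 hφ N
      rwa [← Set.mem_preimage, preimage_mk_image_lateCorrelated hTm] at this
    obtain ⟨n, hn, C, hC, ha⟩ := hφN
    refine ⟨n, hn, le_trans (ENNReal.ofReal_le_ofReal ?_) (le_iSup₂ (f := fun C (_ : C ∈ 𝒞) =>
      ENNReal.ofReal |μ.real (C ∩ (conj T φ)^[n] ⁻¹' C) - μ.real C ^ 2|) C hC)⟩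
    rw [measureReal_inter_conj_preimage hTm φ n (h𝒞 C hC)]
    exact ha.le

end Conjugates

end UniformMixing

theorem corollary1p3 {X : Type*} [MeasurableSpace X] (μ : Measure X) [IsProbabilityMeasure μ]
    (T : X → X) (hT : UniformMixing.IsStrongMixing T μ)
    (𝒞 : Set (Set X)) (h𝒞 : ∀ C ∈ 𝒞, MeasurableSet C) :
    (UniformMixing.familyEntropy μ 𝒞 = 0 →
      Tendsto
        (fun n : ℕ => ⨆ A ∈ 𝒞, ⨆ B ∈ 𝒞,
          ENNReal.ofReal |μ.real (A ∩ T^[n] ⁻¹' B) - μ.real A * μ.real B|)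
        atTop (𝓝 0)) ∧
    (UniformMixing.IsLebesgueSpace μ → UniformMixing.IsInvertible T μ →
      0 < UniformMixing.familyEntropy μ 𝒞 →
      ∃ G : Set (UniformMixing.TransfSpace μ), IsGδ G ∧ Dense G ∧
        ∀ φ : UniformMixing.InvTransf μ, UniformMixing.TransfSpace.mk φ ∈ G →
          0 < limsup
            (fun n : ℕ => ⨆ C ∈ 𝒞,
              ENNReal.ofReal |μ.real (C ∩ (UniformMixing.conj T φ)^[n] ⁻¹' C) - μ.real C ^ 2|)
            atTop) := by
  refine ⟨fun h => ?_, fun hL _ h => ?_⟩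
  · refine UniformMixing.tendsto_iSup_correlation_of_isTotallyBoundedFamily hT h𝒞 ?_
    by_contra hTB
    exact (UniformMixing.familyEntropy_pos μ h𝒞 hTB).ne' h
  · exact UniformMixing.exists_dense_isGδ_forall_limsup_pos hT h𝒞 hL fun hTB =>
      h.ne' (UniformMixing.familyEntropy_eq_zero μ h𝒞 hTB)
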